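/- Let $M$ be a nonempty (Hausdorff, second countable) $C^\infty$ manifold, possibly with boundary or corners, of finite dimension $\dim(M)\ge 2$. Equip the set $\mathrm{Diff}^\infty(M)$ of $C^\infty$-diffeomorphisms of $M$ with the (weak) $C^\infty$ topology, i.e. uniform convergence of all derivatives on compact sets in charts, and equip $[0,1]^\omega$ with the product topology. Then the equivalence relation $[0,1]^\omega/c_0$, defined by $\alpha\sim\beta$ iff $\lim_{n\to\infty}(\alpha(n)-\beta(n))=0$, is Borel reducible to the topological conjugacy relation on $\mathrm{Diff}^\infty(M)$: there is a Borel map $F:[0,1]^\omega\to\mathrm{Diff}^\infty(M)$ such that, for all $\alpha,\beta\in[0,1]^\omega$, $$\lim_{n\to\infty}(\alpha(n)-\beta(n))=0\iff \text{there is a homeomorphism } h:M\to M \text{ with } h\circ F(\alpha)=F(\beta)\circ h .$$ -/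

import Mathlib

open Set Filter Topology
open scoped Manifold ContDiff unitInterval

/-- A Borel reduction from the equivalence relation `r` on `X` to the equivalence relation `s`
on `Y`: a Borel map `f` with `x r y ↔ f x s f y`. -/
def IsBorelReduction {X Y : Type*} [TopologicalSpace X] [TopologicalSpace Y]
    (r : Setoid X) (s : Setoid Y) (f : X → Y) : Prop :=
  @Measurable X Y (borel X) (borel Y) f ∧ ∀ x y : X, r x y ↔ s (f x) (f y)

/-- `r` is Borel reducible to `s`. -/
def BorelReducible {X Y : Type*} [TopologicalSpace X] [TopologicalSpace Y]
    (r : Setoid X) (s : Setoid Y) : Prop :=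
  ∃ f : X → Y, IsBorelReduction r s f

/-- The equivalence relation `[0,1]^ω / c₀` on the Hilbert cube (with the product topology):
two sequences are equivalent when their difference tends to `0`. -/
def c0Relation : Setoid (ℕ → I) where
  r α β := Tendsto (fun n => (α n : ℝ) - (β n : ℝ)) atTop (𝓝 0)
  iseqv :=
    { refl := fun α => by simp
      symm := fun {α β} h => by simpa using h.neg
      trans := fun {α β γ} h₁ h₂ => by simpa using h₁.add h₂ }

section Diffeo

variable {E : Type*} [NormedAddCommGroup E] [NormedSpace ℝ E]
  {H : Type*} [TopologicalSpace H] (J : ModelWithCorners ℝ E H)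
  (M : Type*) [TopologicalSpace M] [ChartedSpace H M]

/-- The group of `C^∞` diffeomorphisms of `M`. -/
abbrev SmoothDiffeo := Diffeomorph J J M M ∞

variable {J M}

/-- The map `g` read in the charts `φ` (in the source) and `ψ` (in the target). -/
noncomputable def localRep (J : ModelWithCorners ℝ E H) (φ ψ : OpenPartialHomeomorph M H) (g : M → M) : E → E :=
  ψ.extend J ∘ g ∘ (φ.extend J).symm

/-- The basic set of the weak `C^∞` topology given by `f`, charts `φ` and `ψ`, a set `K` in the
domain of `φ`, an order `k` and a tolerance `ε`: all diffeomorphisms `g` that map `K` into the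
domain of `ψ` and whose local representative is, together with its derivatives up to order `k`,
`ε`-close to that of `f` on `K`. (Derivatives are taken within `range J`, which is all of `E` if
there is no boundary.) -/
def weakBasicSet (f : SmoothDiffeo J M) (φ ψ : OpenPartialHomeomorph M H) (K : Set M)
    (k : ℕ) (ε : ℝ) : Set (SmoothDiffeo J M) :=
  {g | MapsTo g K ψ.source ∧ ∀ j ≤ k, ∀ x ∈ φ.extend J '' K,
    ‖iteratedFDerivWithin ℝ j (localRep J φ ψ g) (range J) x -
      iteratedFDerivWithin ℝ j (localRep J φ ψ f) (range J) x‖ < ε}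

/-- The (weak) `C^∞` topology on the diffeomorphism group, that is, uniform convergence of all
derivatives on compact sets in charts. -/
instance smoothDiffeoTopology : TopologicalSpace (SmoothDiffeo J M) :=
  TopologicalSpace.generateFrom
    {N | ∃ (f : SmoothDiffeo J M) (φ ψ : OpenPartialHomeomorph M H) (K : Set M) (k : ℕ) (ε : ℝ),
      φ ∈ IsManifold.maximalAtlas J ∞ M ∧ ψ ∈ IsManifold.maximalAtlas J ∞ M ∧
      IsCompact K ∧ K ⊆ φ.source ∧ MapsTo f K ψ.source ∧ 0 < ε ∧
      N = weakBasicSet f φ ψ K k ε}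

variable (J M)

/-- Topological conjugacy of `C^∞` diffeomorphisms of `M`: `f` and `g` are equivalent when
`h ∘ f = g ∘ h` for some homeomorphism `h` of `M`. -/
def topConjugacy : Setoid (SmoothDiffeo J M) where
  r f g := ∃ h : M ≃ₜ M, ∀ x, h (f x) = g (h x)
  iseqv :=
    { refl := fun _ => ⟨Homeomorph.refl M, fun _ => rfl⟩
      symm := fun {f g} ⟨h, hh⟩ => ⟨h.symm, fun x => by
        rw [Homeomorph.symm_apply_eq, hh, Homeomorph.apply_symm_apply]⟩
      trans := fun {f g k} ⟨h₁, hh₁⟩ ⟨h₂, hh₂⟩ => ⟨h₁.trans h₂, fun x => by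
        simp [hh₁, hh₂]⟩ }

end Diffeo

/-! In a chart modelled on `ℂ × W`, place disjoint balls with centres `(a n + i 2⁻ⁿ, 0)`, shrinking
to the segment `[0,1] × {0}`. Let `diskTwist` rotate the `n`-th one by `2π / m n`, where the `m n ≥
2` are distinct; the angle is cut off smoothly near the rim. Extended by the identity, this is a
homeomorphism of `M` that encodes the positions `a`.

If `a n - b n → 0`, a horizontal shear moves the `n`-th ball by `b n - a n`. It is continuous on the
limit segment because the amounts tend to `0`, so it conjugates the two twists
(`exists_homeomorph_conj_diskTwist`).

Conversely, a conjugacy preserves the interior of the set of points of period `m n`. This interior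
is nonempty and lies in the `n`-th ball (`norm_sub_diskCenter_lt_of_mem_interior`), since in the
transition zone near the rim the angle varies strictly with the radius. So a conjugacy matches the
`n`-th balls, and limits of positions `a n` go to the corresponding limits of `b n`
(`conj_apply_eq_of_tendsto`). The positions are first interleaved with a sequence that takes each
value of a dense sequence infinitely often, the same for all `α`. This forces a conjugacy to fix the
segment pointwise, so `α` and `β` have equal limits along every ultrafilter (`tendsto_sub_of_conj`).

Smoothness is bought with rapidly growing `m n`: the small angles make the displacements summable
with all derivatives (`exists_forall_contDiff_diskTwist`). The sum is jointly smooth in the point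
and in a parameter from a normed space containing the Hilbert cube, so the reduction is even
continuous. -/

/-! ### Derivatives in one of two variables -/

section PartialDerivatives

variable {P E F : Type*} [NormedAddCommGroup P] [NormedSpace ℝ P] [NormedAddCommGroup E]
  [NormedSpace ℝ E] [NormedAddCommGroup F] [NormedSpace ℝ F]

/-- The iterated derivative in the second variable is the restriction of the joint iterated
derivative. -/
theorem ContDiffWithinAt.iteratedFDerivWithin_snd {g : P × E → F} {s : Set E} {a : P} {x : E}
    {j : ℕ} (hs : UniqueDiffOn ℝ s) (hx : x ∈ s)
    (hg : ContDiffWithinAt ℝ j g (univ ×ˢ s) (a, x)) :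
    iteratedFDerivWithin ℝ j (fun y => g (a, y)) s x =
      (iteratedFDerivWithin ℝ j g (univ ×ˢ s) (a, x)).compContinuousLinearMap
        fun _ => ContinuousLinearMap.inr ℝ P E := by
  have hS : UniqueDiffOn ℝ ((univ : Set P) ×ˢ s) := uniqueDiffOn_univ.prod hs
  have hax : (a, x) ∈ (univ : Set P) ×ˢ s := ⟨mem_univ _, hx⟩
  obtain ⟨u, hu, hau, hgu⟩ := hg.contDiffOn' le_rfl (by simp)
  rw [insert_eq_of_mem hax] at hgu
  -- Precompose the Taylor series with the affine slice `y ↦ (a, y)`, then use uniqueness of Taylor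
  -- series.
  have key := (hgu.ftaylorSeriesWithin (hS.inter hu)).comp_continuousAffineMap
    ((ContinuousAffineMap.const ℝ E ((a, 0) : P × E)) +
      (ContinuousLinearMap.inr ℝ P E).toContinuousAffineMap)
  have hv : IsOpen {y : E | (a, y) ∈ u} := hu.preimage (by fun_prop)
  have hpre : (((ContinuousAffineMap.const ℝ E ((a, 0) : P × E)) +
      (ContinuousLinearMap.inr ℝ P E).toContinuousAffineMap) ⁻¹' (univ ×ˢ s ∩ u) : Set E) =
      s ∩ {y : E | (a, y) ∈ u} := by
    ext y; simp
  rw [hpre] at key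
  have h2 := key.eq_iteratedFDerivWithin_of_uniqueDiffOn le_rfl (hs.inter hv) ⟨hx, hau⟩
  rw [iteratedFDerivWithin_inter_open hv hau] at h2
  rw [← iteratedFDerivWithin_inter_open hu hau]
  have h3 : (g ∘ ((ContinuousAffineMap.const ℝ E ((a, 0) : P × E)) +
      (ContinuousLinearMap.inr ℝ P E).toContinuousAffineMap : E →ᴬ[ℝ] P × E)) =
      fun y => g (a, y) := by
    ext y; simp
  rw [h3] at h2
  rw [← h2]
  simp [ftaylorSeriesWithin]

/-- The iterated derivatives in the second variable of a jointly smooth function are jointly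
continuous. -/
theorem ContDiffWithinAt.continuousWithinAt_iteratedFDerivWithin_snd {g : P × E → F} {s : Set E}
    {a : P} {x : E} {j : ℕ} (hs : UniqueDiffOn ℝ s) (hx : x ∈ s)
    (hg : ContDiffWithinAt ℝ j g (univ ×ˢ s) (a, x)) :
    ContinuousWithinAt (fun z : P × E => iteratedFDerivWithin ℝ j (fun y => g (z.1, y)) s z.2)
      (univ ×ˢ s) (a, x) := by
  have hS : UniqueDiffOn ℝ ((univ : Set P) ×ˢ s) := uniqueDiffOn_univ.prod hs
  have hax : (a, x) ∈ (univ : Set P) ×ˢ s := ⟨mem_univ _, hx⟩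
  have h1 := hg.continuousWithinAt_iteratedFDerivWithin hS le_rfl hax
  have h2 : ∀ᶠ z in 𝓝[univ ×ˢ s] (a, x), ContDiffWithinAt ℝ j g (univ ×ˢ s) z := by
    have := hg.eventually (by simp)
    rwa [insert_eq_of_mem hax] at this
  have h3 : ContinuousWithinAt (fun z : P × E =>
      (ContinuousMultilinearMap.compContinuousLinearMapL (𝕜 := ℝ) (F := F)
        fun _ : Fin j => ContinuousLinearMap.inr ℝ P E)
          (iteratedFDerivWithin ℝ j g (univ ×ˢ s) z)) (univ ×ˢ s) (a, x) :=
    (ContinuousMultilinearMap.compContinuousLinearMapL (𝕜 := ℝ) (F := F)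
      fun _ : Fin j => ContinuousLinearMap.inr ℝ P E).continuous.continuousAt.comp_continuousWithinAt h1
  refine h3.congr_of_eventuallyEq ?_ (hg.iteratedFDerivWithin_snd hs hx)
  filter_upwards [h2, self_mem_nhdsWithin] with z hz hzs
  exact hz.iteratedFDerivWithin_snd hs hzs.2

end PartialDerivatives

/-! ### Smooth families are continuous for the weak `C^∞` topology -/

section ParametrizedDiffeo

variable {P : Type*} [NormedAddCommGroup P] [NormedSpace ℝ P]
  {E : Type*} [NormedAddCommGroup E] [NormedSpace ℝ E]
  {H : Type*} [TopologicalSpace H] {J : ModelWithCorners ℝ E H}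
  {M : Type*} [TopologicalSpace M] [ChartedSpace H M]

/-- The local representative of a smooth family of maps depends smoothly on all variables. -/
theorem contDiffWithinAt_localRep {Φ : P × M → M}
    (hΦ : ContMDiff (𝓘(ℝ, P).prod J) J ∞ Φ) {φ ψ : OpenPartialHomeomorph M H}
    (hφ : φ ∈ IsManifold.maximalAtlas J ∞ M) (hψ : ψ ∈ IsManifold.maximalAtlas J ∞ M)
    {a : P} {m : M} (hm : m ∈ φ.source) (hΦm : Φ (a, m) ∈ ψ.source) :
    ContDiffWithinAt ℝ ∞ (fun z : P × E => localRep J φ ψ (fun m => Φ (z.1, m)) z.2)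
      (univ ×ˢ range J) (a, φ.extend J m) := by
  have h1 : ContMDiffWithinAt 𝓘(ℝ, E) J ∞ (φ.extend J).symm (range J) (φ.extend J m) := by
    have h := contMDiffOn_extend_symm hφ
    rw [← φ.extend_target'] at h
    have hm' : φ.extend J m ∈ (φ.extend J).target :=
      (φ.extend J).map_source (by rwa [φ.extend_source])
    exact (h _ hm').mono_of_mem_nhdsWithin (φ.extend_target_mem_nhdsWithin hm)
  have hinv : (φ.extend J).symm (φ.extend J m) = m := φ.extend_left_inv hm
  have h2 : ContMDiffWithinAt (𝓘(ℝ, P).prod 𝓘(ℝ, E)) (𝓘(ℝ, P).prod J) ∞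
      (fun z : P × E => (z.1, (φ.extend J).symm z.2)) (univ ×ˢ range J) (a, φ.extend J m) := by
    refine contMDiffWithinAt_fst.prodMk ?_
    exact ContMDiffWithinAt.comp (t := range J) (a, φ.extend J m) h1 contMDiffWithinAt_snd
      (fun z hz => hz.2)
  have h3 : ContMDiffWithinAt (𝓘(ℝ, P).prod 𝓘(ℝ, E)) J ∞
      (fun z : P × E => Φ (z.1, (φ.extend J).symm z.2)) (univ ×ˢ range J) (a, φ.extend J m) :=
    hΦ.contMDiffAt.comp_contMDiffWithinAt _ h2
  have h4 : ContMDiffAt J 𝓘(ℝ, E) ∞ (ψ.extend J) (Φ (a, (φ.extend J).symm (φ.extend J m))) := by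
    rw [hinv]
    exact ψ.contMDiffAt_extend hψ hΦm
  have h5 := h4.comp_contMDiffWithinAt (a, φ.extend J m) h3
  rw [← modelWithCornersSelf_prod, chartedSpaceSelf_prod] at h5
  exact h5.contDiffWithinAt

/-- A family of diffeomorphisms that is jointly smooth in the parameter and the point is
continuous for the weak `C^∞` topology. -/
theorem continuous_smoothDiffeo_of_contMDiff {Φ : P × M → M}
    (hΦ : ContMDiff (𝓘(ℝ, P).prod J) J ∞ Φ) (F : P → SmoothDiffeo J M)
    (hF : ∀ a m, F a m = Φ (a, m)) : Continuous F := by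
  refine continuous_generateFrom_iff.2 ?_
  rintro _ ⟨f, φ, ψ, K, k, ε, hφ, hψ, hK, hKφ, hfK, hε, rfl⟩
  have hFeq : ∀ a, (F a : M → M) = fun m => Φ (a, m) := fun a => funext (hF a)
  have hcont : Continuous Φ := hΦ.continuous
  rw [isOpen_iff_mem_nhds]
  rintro a ⟨ha1, ha2⟩
  -- The fixed `f` counts as a constant family, so that the same joint continuity applies to it.
  have hsmooth_f : ContMDiff (𝓘(ℝ, P).prod J) J ∞ (fun z : P × M => f z.2) :=
    f.contMDiff.comp contMDiff_snd
  have key : ∀ m ∈ K, ∀ᶠ z : P × M in 𝓝 (a, m), F z.1 z.2 ∈ ψ.source ∧ ∀ j ≤ k,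
      ‖iteratedFDerivWithin ℝ j (localRep J φ ψ (F z.1)) (range J) (φ.extend J z.2) -
        iteratedFDerivWithin ℝ j (localRep J φ ψ f) (range J) (φ.extend J z.2)‖ < ε := by
    intro m hm
    have hΦm : Φ (a, m) ∈ ψ.source := hF a m ▸ ha1 hm
    refine Filter.Eventually.and ?_ ?_
    · have := hcont.continuousAt.eventually (ψ.open_source.mem_nhds hΦm)
      filter_upwards [this] with z hz
      rw [hF]; exact hz
    · have hfin : ∀ j ∈ Iic k, ∀ᶠ z : P × M in 𝓝 (a, m),
          ‖iteratedFDerivWithin ℝ j (localRep J φ ψ (F z.1)) (range J) (φ.extend J z.2) -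
          iteratedFDerivWithin ℝ j (localRep J φ ψ f) (range J) (φ.extend J z.2)‖ < ε := by
        intro j hj
        have hmem : φ.extend J m ∈ range J := mem_range_self _
        have c1 := ((contDiffWithinAt_localRep hΦ hφ hψ (hKφ hm) hΦm).of_le
          (m := (j : WithTop ℕ∞)) (by exact_mod_cast le_top)).continuousWithinAt_iteratedFDerivWithin_snd J.uniqueDiffOn hmem
        have c2 := ((contDiffWithinAt_localRep (a := a) hsmooth_f hφ hψ (hKφ hm) (hfK hm)).of_le
          (m := (j : WithTop ℕ∞)) (by exact_mod_cast le_top)).continuousWithinAt_iteratedFDerivWithin_snd J.uniqueDiffOn hmem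
        have c3 := (c1.sub c2).norm
        have hlt : ‖iteratedFDerivWithin ℝ j (localRep J φ ψ (F a)) (range J) (φ.extend J m) -
          iteratedFDerivWithin ℝ j (localRep J φ ψ f) (range J) (φ.extend J m)‖ < ε :=
          ha2 j hj _ (mem_image_of_mem _ hm)
        rw [hFeq a] at hlt
        have c4 := c3.eventually (isOpen_Iio.mem_nhds hlt)
        have ht : Tendsto (fun z : P × M => (z.1, φ.extend J z.2)) (𝓝 (a, m))
            (𝓝[univ ×ˢ range J] (a, φ.extend J m)) := by
          refine tendsto_nhdsWithin_iff.2 ⟨?_, Eventually.of_forall fun z =>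
            ⟨mem_univ _, mem_range_self _⟩⟩
          exact (continuousAt_fst).prodMk
            ((φ.continuousAt_extend (hKφ hm)).comp continuousAt_snd)
        filter_upwards [ht.eventually c4] with z hz
        rw [hFeq z.1]
        exact hz
      exact (eventually_all_finite (finite_Iic k)).2 hfin
  -- Compactness of `K` turns the neighbourhoods of the points `(a, m)` into one neighbourhood of
  -- `a`.
  have := hK.eventually_forall_of_forall_eventually
    (P := fun b m => F b m ∈ ψ.source ∧ ∀ j ≤ k,
      ‖iteratedFDerivWithin ℝ j (localRep J φ ψ (F b)) (range J) (φ.extend J m) -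
        iteratedFDerivWithin ℝ j (localRep J φ ψ f) (range J) (φ.extend J m)‖ < ε) key
  filter_upwards [this] with b hb
  refine ⟨fun m hm => (hb m hm).1, ?_⟩
  rintro j hj _ ⟨m, hm, rfl⟩
  exact (hb m hm).2 j hj

end ParametrizedDiffeo

/-! ### Strict monotonicity of the smooth transition -/

theorem expNegInvGlue_lt_of_lt {x y : ℝ} (hx : 0 < x) (hxy : x < y) :
    expNegInvGlue x < expNegInvGlue y := by
  have hy : 0 < y := hx.trans hxy
  simp only [expNegInvGlue, hx.not_ge, hy.not_ge, if_false]
  exact Real.exp_lt_exp.2 (neg_lt_neg (inv_strictAnti₀ hx hxy))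

theorem Real.smoothTransition_lt_of_lt {x y : ℝ} (hxy : x < y) (hy0 : 0 < y) (hy1 : y < 1) :
    Real.smoothTransition x < Real.smoothTransition y := by
  rcases le_or_gt x 0 with hx | hx
  · rw [Real.smoothTransition.zero_of_nonpos hx]
    exact Real.smoothTransition.pos_of_pos hy0
  · have h1 := expNegInvGlue_lt_of_lt hx hxy
    have h2 : expNegInvGlue (1 - y) < expNegInvGlue (1 - x) :=
      expNegInvGlue_lt_of_lt (by linarith) (by linarith)
    have h3 := expNegInvGlue.pos_of_pos hx
    have h4 : 0 < expNegInvGlue (1 - y) := expNegInvGlue.pos_of_pos (by linarith)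
    unfold Real.smoothTransition
    rw [div_lt_div_iff₀ (Real.smoothTransition.pos_denom x) (Real.smoothTransition.pos_denom y)]
    nlinarith

/-! ### The twist maps -/

noncomputable section Twist

variable {W : Type*}

/-- Rotation of the first factor. -/
def rotFst (s : ℝ) (x : ℂ × W) : ℂ × W := (Complex.exp (s * Complex.I) * x.1, x.2)

@[simp]
theorem rotFst_zero (x : ℂ × W) : rotFst 0 x = x := by simp [rotFst]

theorem rotFst_rotFst (s t : ℝ) (x : ℂ × W) : rotFst s (rotFst t x) = rotFst (s + t) x := by
  simp [rotFst, add_mul, Complex.exp_add, mul_assoc]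

variable [NormedAddCommGroup W]

/-- The imaginary part of the centre of the `n`-th disk. -/
def diskHeight (n : ℕ) : ℝ := (1 / 2) ^ n

theorem diskHeight_pos (n : ℕ) : 0 < diskHeight n := by unfold diskHeight; positivity

theorem diskHeight_le_one (n : ℕ) : diskHeight n ≤ 1 :=
  pow_le_one₀ (by norm_num) (by norm_num)

theorem tendsto_diskHeight : Tendsto diskHeight atTop (𝓝 0) :=
  tendsto_pow_atTop_nhds_zero_of_lt_one (by norm_num) (by norm_num)

theorem diskHeight_le_half {m n : ℕ} (h : m < n) : diskHeight n ≤ diskHeight m / 2 := by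
  have h1 : diskHeight n ≤ diskHeight (m + 1) :=
    pow_le_pow_of_le_one (by norm_num) (by norm_num) h
  rw [show diskHeight (m + 1) = diskHeight m / 2 by unfold diskHeight; ring] at h1
  exact h1

/-- The horizontal strips of relative half-width `1 / 3` around the heights are disjoint. -/
theorem eq_of_mem_strips {m n : ℕ} {y : ℝ} (hm : |y - diskHeight m| < diskHeight m / 3)
    (hn : |y - diskHeight n| < diskHeight n / 3) : m = n := by
  rw [abs_lt] at hm hn
  by_contra hne
  rcases lt_or_gt_of_ne hne with h | h
  -- The upper strip lies above `2/3` of its height, the lower one below `4/3` of at most half that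
  -- height.
  · have := diskHeight_le_half h; linarith
  · have := diskHeight_le_half h; linarith

/-- The centre of the `n`-th disk in horizontal position `t`. -/
def diskCenter (W : Type*) [NormedAddCommGroup W] (n : ℕ) (t : ℝ) : ℂ × W :=
  ((t : ℂ) + (diskHeight n : ℂ) * Complex.I, 0)

/-- The squared Euclidean length on `ℂ × W`. -/
def sqLength (x : ℂ × W) : ℝ := Complex.normSq x.1 + ‖x.2‖ ^ 2

/-- A bump function that is `1` on the ball of radius `diskHeight n / 8`. -/
def diskBump (n : ℕ) (x : ℂ × W) : ℝ :=
  Real.smoothTransition (2 - sqLength x / (diskHeight n / 8) ^ 2)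

/-- A cutoff that is `1` on the unit interval. -/
def positionCutoff (t : ℝ) : ℝ := Real.smoothTransition (2 - t ^ 2)

/-- The displacement vector of the twist of the `n`-th disk in position `t` by the angle `θ`. -/
def twistDisplacement (n : ℕ) (θ t : ℝ) (x : ℂ × W) : ℂ × W :=
  rotFst (θ * (positionCutoff t * diskBump n (x - diskCenter W n t))) (x - diskCenter W n t) -
    (x - diskCenter W n t)

/-- The map twisting the `n`-th disk, in position `a n`, by the angle `θ n`, for all `n`. -/
def diskTwist (θ a : ℕ → ℝ) (x : ℂ × W) : ℂ × W :=
  x + ∑' n, twistDisplacement n (θ n) (a n) x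

-- Using the Euclidean length in the bump keeps the twisting angle constant along orbits.
@[simp]
theorem sqLength_rotFst (s : ℝ) (x : ℂ × W) : sqLength (rotFst s x) = sqLength x := by
  simp [sqLength, rotFst, Complex.normSq_eq_norm_sq, Complex.norm_exp_ofReal_mul_I]

@[simp]
theorem diskBump_rotFst (n : ℕ) (s : ℝ) (x : ℂ × W) : diskBump n (rotFst s x) = diskBump n x := by
  simp [diskBump]

theorem norm_lt_of_sqLength_lt {x : ℂ × W} {r : ℝ} (hr : 0 < r) (h : sqLength x < r ^ 2) :
    ‖x‖ < r := by
  unfold sqLength at h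
  rw [Complex.normSq_eq_norm_sq] at h
  rw [Prod.norm_def, max_lt_iff]
  exact ⟨lt_of_pow_lt_pow_left₀ 2 hr.le (by nlinarith [sq_nonneg ‖x.2‖]),
    lt_of_pow_lt_pow_left₀ 2 hr.le (by nlinarith [sq_nonneg ‖x.1‖])⟩

/-- The bump vanishes once the squared length reaches `2 (r/8)²`, which is less than `(r/4)²`. -/
theorem norm_lt_of_diskBump_ne_zero {n : ℕ} {x : ℂ × W} (h : diskBump n x ≠ 0) :
    ‖x‖ < diskHeight n / 4 := by
  have hr : 0 < diskHeight n := diskHeight_pos n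
  rw [diskBump, Ne, Real.smoothTransition.zero_iff_nonpos, not_le, sub_pos, div_lt_iff₀
    (by positivity)] at h
  exact norm_lt_of_sqLength_lt (by positivity) (by nlinarith)

theorem abs_im_lt_of_diskBump_ne_zero {n : ℕ} {t : ℝ} {x : ℂ × W}
    (h : diskBump n (x - diskCenter W n t) ≠ 0) :
    |x.1.im - diskHeight n| < diskHeight n / 4 := by
  have h1 := norm_lt_of_diskBump_ne_zero h
  have h2 : |(x - diskCenter W n t).1.im| ≤ ‖x - diskCenter W n t‖ :=
    (Complex.abs_im_le_norm _).trans (norm_fst_le _)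
  simpa [diskCenter] using h2.trans_lt h1

theorem eq_of_diskBump_ne_zero {m n : ℕ} {s t : ℝ} {x : ℂ × W}
    (hm : diskBump m (x - diskCenter W m s) ≠ 0) (hn : diskBump n (x - diskCenter W n t) ≠ 0) :
    m = n := by
  have := diskHeight_pos m
  have := diskHeight_pos n
  exact eq_of_mem_strips ((abs_im_lt_of_diskBump_ne_zero hm).trans (by linarith))
    ((abs_im_lt_of_diskBump_ne_zero hn).trans (by linarith))

theorem twistDisplacement_of_diskBump_eq_zero {n : ℕ} {θ t : ℝ} {x : ℂ × W}
    (h : diskBump n (x - diskCenter W n t) = 0) : twistDisplacement n θ t x = 0 := by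
  simp [twistDisplacement, h]

/-- Supports of different bumps lie in disjoint strips, so a single term of the series survives. -/
theorem diskTwist_of_diskBump_ne_zero (θ : ℕ → ℝ) {a : ℕ → ℝ} {n : ℕ} {x : ℂ × W}
    (h : diskBump n (x - diskCenter W n (a n)) ≠ 0) :
    diskTwist θ a x = diskCenter W n (a n) + rotFst
      (θ n * (positionCutoff (a n) * diskBump n (x - diskCenter W n (a n))))
      (x - diskCenter W n (a n)) := by
  rw [diskTwist, tsum_eq_single n]
  · rw [twistDisplacement]; abel
  · intro m hm
    refine twistDisplacement_of_diskBump_eq_zero ?_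
    by_contra h'
    exact hm (eq_of_diskBump_ne_zero h' h)

theorem diskTwist_of_forall_diskBump_eq_zero (θ : ℕ → ℝ) {a : ℕ → ℝ} {x : ℂ × W}
    (h : ∀ n, diskBump n (x - diskCenter W n (a n)) = 0) : diskTwist θ a x = x := by
  simp [diskTwist, twistDisplacement_of_diskBump_eq_zero (h _)]

theorem diskTwist_sub_diskCenter (θ : ℕ → ℝ) {a : ℕ → ℝ} {n : ℕ} {x : ℂ × W}
    (h : diskBump n (x - diskCenter W n (a n)) ≠ 0) :
    diskTwist θ a x - diskCenter W n (a n) = rotFst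
      (θ n * (positionCutoff (a n) * diskBump n (x - diskCenter W n (a n))))
      (x - diskCenter W n (a n)) := by
  rw [diskTwist_of_diskBump_ne_zero θ h, add_sub_cancel_left]

/-- A twist keeps each point in its own ball with the same bump value, so angles add. Inverses and
iterates of twists are therefore twists. -/
theorem diskTwist_add (θ θ' a : ℕ → ℝ) (x : ℂ × W) :
    diskTwist (θ + θ') a x = diskTwist θ a (diskTwist θ' a x) := by
  by_cases h : ∀ n, diskBump n (x - diskCenter W n (a n)) = 0
  · simp [diskTwist_of_forall_diskBump_eq_zero _ h]
  · push Not at h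
    obtain ⟨n, hn⟩ := h
    have h1 := diskTwist_sub_diskCenter θ' hn
    have h2 : diskBump n (diskTwist θ' a x - diskCenter W n (a n)) ≠ 0 := by
      rwa [h1, diskBump_rotFst]
    rw [diskTwist_of_diskBump_ne_zero _ hn, diskTwist_of_diskBump_ne_zero _ h2, h1,
      rotFst_rotFst, diskBump_rotFst, ← add_mul, Pi.add_apply]

@[simp]
theorem diskTwist_zero (a : ℕ → ℝ) (x : ℂ × W) : diskTwist 0 a x = x := by
  simp [diskTwist, twistDisplacement]

theorem diskTwist_neg_diskTwist (θ a : ℕ → ℝ) (x : ℂ × W) :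
    diskTwist (-θ) a (diskTwist θ a x) = x := by
  rw [← diskTwist_add, neg_add_cancel, diskTwist_zero]

theorem diskTwist_diskTwist_neg (θ a : ℕ → ℝ) (x : ℂ × W) :
    diskTwist θ a (diskTwist (-θ) a x) = x := by
  rw [← diskTwist_add, add_neg_cancel, diskTwist_zero]

theorem iterate_diskTwist (θ a : ℕ → ℝ) (k : ℕ) (x : ℂ × W) :
    (diskTwist θ a)^[k] x = diskTwist (k • θ) a x := by
  induction k with
  | zero => simp
  | succ k ih => rw [Function.iterate_succ_apply', ih, ← diskTwist_add, succ_nsmul']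

theorem norm_diskCenter_le (n : ℕ) {t : ℝ} : ‖diskCenter W n t‖ ≤ |t| + 1 := by
  rw [diskCenter, Prod.norm_def, norm_zero, max_le_iff]
  refine ⟨(norm_add_le _ _).trans ?_, by positivity⟩
  have h1 := diskHeight_le_one n
  have h2 := diskHeight_pos n
  simp [abs_of_pos h2, h1]

theorem abs_lt_two_of_positionCutoff_ne_zero {t : ℝ} (h : positionCutoff t ≠ 0) : |t| < 2 := by
  rw [positionCutoff, Ne, Real.smoothTransition.zero_iff_nonpos, not_le] at h
  exact abs_lt_of_sq_lt_sq (by linarith) (by norm_num)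

theorem positionCutoff_of_mem_Icc {t : ℝ} (h : t ∈ Icc (0 : ℝ) 1) : positionCutoff t = 1 :=
  Real.smoothTransition.one_of_one_le (by nlinarith [h.1, h.2])

/-- The position cutoff bounds `t` as well as `x`; this gives a compact support in both variables,
as needed for uniform derivative bounds. -/
theorem twistDisplacement_support {n : ℕ} {θ t : ℝ} {x : ℂ × W}
    (h : twistDisplacement n θ t x ≠ 0) : |t| < 2 ∧ ‖x‖ < 4 := by
  have hb : diskBump n (x - diskCenter W n t) ≠ 0 :=
    fun h' => h (twistDisplacement_of_diskBump_eq_zero h')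
  have ht : |t| < 2 := by
    refine abs_lt_two_of_positionCutoff_ne_zero fun h' => h ?_
    simp [twistDisplacement, h']
  refine ⟨ht, ?_⟩
  have h1 := norm_lt_of_diskBump_ne_zero hb
  have h2 := norm_diskCenter_le (W := W) n (t := t)
  have h3 := norm_le_norm_sub_add x (diskCenter W n t)
  have h4 := diskHeight_le_one n
  linarith

theorem diskTwist_of_four_le_norm (θ a : ℕ → ℝ) {x : ℂ × W} (hx : 4 ≤ ‖x‖) :
    diskTwist θ a x = x := by
  have : ∀ n, twistDisplacement n (θ n) (a n) x = 0 := fun n => by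
    by_contra h
    exact hx.not_gt (twistDisplacement_support h).2
  simp [diskTwist, this]

/-! ### Periods of points under the twist -/

section Period

variable {θ a : ℕ → ℝ} {n : ℕ} {x : ℂ × W}

/-- The `k`-th iterate rotates by `k` times the local angle. Points on the axis are fixed whatever
the angle, hence `hz`. -/
theorem isPeriodicPt_diskTwist_iff (h : diskBump n (x - diskCenter W n (a n)) ≠ 0)
    (hz : (x - diskCenter W n (a n)).1 ≠ 0) (k : ℕ) :
    Function.IsPeriodicPt (diskTwist θ a) k x ↔ ∃ l : ℤ,
      k * (θ n * (positionCutoff (a n) * diskBump n (x - diskCenter W n (a n)))) =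
        l * (2 * Real.pi) := by
  rw [Function.IsPeriodicPt, Function.IsFixedPt, iterate_diskTwist,
    diskTwist_of_diskBump_ne_zero _ h, ← eq_sub_iff_add_eq', rotFst, Prod.ext_iff]
  simp only [and_true]
  rw [mul_eq_right₀ hz, Complex.exp_eq_one_iff]
  refine exists_congr fun l => ?_
  rw [← mul_assoc (l : ℂ), mul_left_inj' Complex.I_ne_zero]
  simp only [Pi.smul_apply, nsmul_eq_mul]
  rw [← Complex.ofReal_inj]
  push_cast
  ring_nf

theorem isPeriodicPt_diskTwist_iff_dvd {m : ℕ → ℕ} (hm : ∀ n, m n ≠ 0)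
    (h : diskBump n (x - diskCenter W n (a n)) = 1) (ha : a n ∈ Icc (0 : ℝ) 1)
    (hz : (x - diskCenter W n (a n)).1 ≠ 0) (k : ℕ) :
    Function.IsPeriodicPt (diskTwist (fun n => 2 * Real.pi / m n) a) k x ↔ m n ∣ k := by
  rw [isPeriodicPt_diskTwist_iff (by rw [h]; exact one_ne_zero) hz, h,
    positionCutoff_of_mem_Icc ha, ← Int.natCast_dvd_natCast]
  have hm' : (m n : ℝ) ≠ 0 := Nat.cast_ne_zero.2 (hm n)
  refine exists_congr fun l => ?_
  rw [mul_one, mul_one, mul_div_assoc', div_eq_iff hm', ← Int.cast_inj (α := ℝ)]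
  push_cast
  constructor
  · intro h'
    exact mul_right_cancel₀ (b := 2 * Real.pi) (by positivity) (by linarith)
  · intro h'; rw [h']; ring

theorem minimalPeriod_diskTwist {m : ℕ → ℕ} (hm : ∀ n, m n ≠ 0)
    (h : diskBump n (x - diskCenter W n (a n)) = 1) (ha : a n ∈ Icc (0 : ℝ) 1)
    (hz : (x - diskCenter W n (a n)).1 ≠ 0) :
    Function.minimalPeriod (diskTwist (fun n => 2 * Real.pi / m n) a) x = m n := by
  rw [← Nat.dvd_right_iff_eq]
  intro k
  rw [← Function.isPeriodicPt_iff_minimalPeriod_dvd]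
  exact isPeriodicPt_diskTwist_iff_dvd hm h ha hz k

theorem continuous_sqLength : Continuous (sqLength : ℂ × W → ℝ) :=
  (Complex.continuous_normSq.comp continuous_fst).add (continuous_snd.norm.pow 2)

theorem continuous_diskBump (n : ℕ) : Continuous (diskBump n : ℂ × W → ℝ) :=
  Real.smoothTransition.continuous.comp
    (continuous_const.sub (continuous_sqLength.div_const _))

/-- There is a small open set all of whose points have period `m n`. -/
theorem exists_mem_interior_minimalPeriod_diskTwist {m : ℕ → ℕ} (hm : ∀ n, m n ≠ 0)
    (ha : a n ∈ Icc (0 : ℝ) 1) :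
    ∃ x : ℂ × W, ‖x‖ < 4 ∧ x ∈ interior
      {x | Function.minimalPeriod (diskTwist (fun n => 2 * Real.pi / m n) a) x = m n} := by
  have hr := diskHeight_pos n
  have hb : ∀ y : ℂ × W, sqLength (y - diskCenter W n (a n)) < (diskHeight n / 8) ^ 2 →
      diskBump n (y - diskCenter W n (a n)) = 1 := by
    intro y hy
    refine Real.smoothTransition.one_of_one_le ?_
    have := (div_le_one (by positivity : 0 < (diskHeight n / 8) ^ 2)).2 hy.le
    linarith
  -- The offset `r/16` stays on the plateau of radius `r/8` but leaves the axis, whose points are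
  -- fixed.
  have hx : sqLength ((diskCenter W n (a n) + (((diskHeight n / 16 : ℝ) : ℂ), 0)) -
      diskCenter W n (a n)) < (diskHeight n / 8) ^ 2 := by
    rw [add_sub_cancel_left]
    simp only [sqLength, Complex.normSq_ofReal, norm_zero]
    nlinarith
  refine ⟨diskCenter W n (a n) + (((diskHeight n / 16 : ℝ) : ℂ), 0), ?_, ?_⟩
  · have h1 := norm_lt_of_diskBump_ne_zero (n := n) (by rw [hb _ hx]; exact one_ne_zero)
    have h2 := norm_diskCenter_le (W := W) n (t := a n)
    have h3 := norm_le_norm_sub_add (diskCenter W n (a n) + (((diskHeight n / 16 : ℝ) : ℂ), 0))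
      (diskCenter W n (a n))
    have h4 := diskHeight_le_one n
    rw [abs_of_nonneg ha.1] at h2
    linarith [ha.2]
  · rw [mem_interior]
    refine ⟨{y | sqLength (y - diskCenter W n (a n)) < (diskHeight n / 8) ^ 2} ∩
      {y | (y - diskCenter W n (a n)).1 ≠ 0}, ?_, ?_, hx, ?_⟩
    · rintro y ⟨hy1, hy2⟩
      exact minimalPeriod_diskTwist hm (hb y hy1) ha hy2
    · exact (isOpen_lt (continuous_sqLength.comp (by fun_prop)) continuous_const).inter
        (isOpen_ne_fun (by fun_prop) continuous_const)
    · simp [hr.ne']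

/-- The interior of the set of points of period `m n` is contained in a small disk around the
centre of the `n`-th disk. -/
theorem norm_sub_diskCenter_lt_of_mem_interior [NormedSpace ℝ W] {m : ℕ → ℕ} (hm : ∀ n, 2 ≤ m n)
    (hinj : Function.Injective m) (ha : ∀ n, a n ∈ Icc (0 : ℝ) 1)
    (hx : x ∈ interior
      {x | Function.minimalPeriod (diskTwist (fun n => 2 * Real.pi / m n) a) x = m n}) :
    ‖x - diskCenter W n (a n)‖ < diskHeight n := by
  have hm0 : ∀ n, m n ≠ 0 := fun n => by have := hm n; omega
  have hper : Function.minimalPeriod (diskTwist (fun n => 2 * Real.pi / m n) a) x = m n := by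
    have := interior_subset hx
    exact this
  have hnf : diskTwist (fun n => 2 * Real.pi / m n) a x ≠ x := by
    intro h
    have : Function.minimalPeriod (diskTwist (fun n => 2 * Real.pi / m n) a) x = 1 :=
      Function.minimalPeriod_eq_one_iff_isFixedPt.2 h
    have := hm n
    omega
  obtain ⟨l, hl⟩ : ∃ l, diskBump l (x - diskCenter W l (a l)) ≠ 0 := by
    by_contra! h
    exact hnf (diskTwist_of_forall_diskBump_eq_zero _ h)
  set v := x - diskCenter W l (a l) with hv
  have hz : v.1 ≠ 0 := by
    intro h
    apply hnf
    rw [diskTwist_of_diskBump_ne_zero _ hl, ← hv]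
    have : rotFst ((2 * Real.pi / m l) * (positionCutoff (a l) * diskBump l v)) v = v := by
      ext1 <;> simp [rotFst, h]
    rw [this, hv]; abel
  have hQ : 0 < sqLength v := by
    have := Complex.normSq_pos.2 hz
    unfold sqLength; positivity
  have hml : (0 : ℝ) < m l := Nat.cast_pos.2 (Nat.pos_of_ne_zero (hm0 l))
  have hmn : (0 : ℝ) < m n := Nat.cast_pos.2 (Nat.pos_of_ne_zero (hm0 n))
  -- In the transition zone, move radially: near `u = 1` the point `y u` has period `m n`, so `c u`
  -- is an integer. Being continuous, `c` is locally constant, while the bump strictly decreases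
  -- outwards.
  have hone : diskBump l v = 1 := by
    by_contra hne
    let y : ℝ → ℂ × W := fun u => diskCenter W l (a l) + u • v
    have hy : Continuous y := by fun_prop
    have hy1 : y 1 = x := by simp [y, hv]
    have hyv : ∀ u, y u - diskCenter W l (a l) = u • v := fun u => add_sub_cancel_left _ _
    let c : ℝ → ℝ := fun u => m n / m l * diskBump l (u • v)
    have hc : Continuous c := continuous_const.mul ((continuous_diskBump l).comp (by fun_prop))
    have hint : ∀ᶠ u in 𝓝 (1 : ℝ), ∃ k : ℤ, c u = k := by
      have e1 : ∀ᶠ u in 𝓝 (1 : ℝ), y u ∈ interior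
          {x | Function.minimalPeriod (diskTwist (fun n => 2 * Real.pi / m n) a) x = m n} :=
        hy.continuousAt.eventually (isOpen_interior.mem_nhds (by rwa [hy1]))
      have e2 : ∀ᶠ u in 𝓝 (1 : ℝ), diskBump l (u • v) ≠ 0 := by
        have : Continuous fun u : ℝ => diskBump l (u • v) :=
          (continuous_diskBump l).comp (by fun_prop)
        exact this.continuousAt.eventually_ne (by simpa using hl)
      filter_upwards [e1, e2, eventually_ne_nhds (one_ne_zero : (1 : ℝ) ≠ 0)] with u h1 h2 h3
      have hp := Function.isPeriodicPt_minimalPeriod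
        (diskTwist (fun n => 2 * Real.pi / m n) a) (y u)
      have h1' := interior_subset h1
      rw [mem_ofPred_eq] at h1'
      rw [h1'] at hp
      rw [isPeriodicPt_diskTwist_iff (n := l) (by rwa [hyv])
        (by rw [hyv]; exact smul_ne_zero h3 hz), hyv, positionCutoff_of_mem_Icc (ha l)] at hp
      obtain ⟨k, hk⟩ := hp
      refine ⟨k, mul_right_cancel₀ (b := 2 * Real.pi) (by positivity) ?_⟩
      rw [← hk]
      simp only [c]
      field_simp
    have hconst : ∀ᶠ u in 𝓝 (1 : ℝ), c u = c 1 := by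
      obtain ⟨k, hk⟩ := hint.self_of_nhds
      have : ∀ᶠ u in 𝓝 (1 : ℝ), |c u - c 1| < 1 := by
        have := Metric.continuousAt_iff'.1 (hc.continuousAt (x := 1)) 1 one_pos
        simpa only [Real.dist_eq] using this
      filter_upwards [this, hint] with u h1 ⟨k', hk'⟩
      rw [hk, hk'] at h1 ⊢
      have h2 : |k' - k| < 1 := by exact_mod_cast h1
      rw [Int.abs_lt_one_iff, sub_eq_zero] at h2
      rw [h2]
    obtain ⟨u, hu, hu1⟩ : ∃ u, c u = c 1 ∧ 1 < u := by
      have := (hconst.filter_mono nhdsWithin_le_nhds).and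
        (self_mem_nhdsWithin : Ioi (1 : ℝ) ∈ 𝓝[>] (1 : ℝ))
      exact this.exists
    have hbeq : diskBump l (u • v) = diskBump l v := by
      have := mul_left_cancel₀ (by positivity : (m n / m l : ℝ) ≠ 0) hu
      simpa using this
    have hsq : sqLength (u • v) = u ^ 2 * sqLength v := by
      simp only [sqLength, Prod.smul_fst, Prod.smul_snd, Complex.normSq_eq_norm_sq, norm_smul,
        Real.norm_eq_abs, mul_pow, sq_abs]
      ring
    have hr := diskHeight_pos l
    refine absurd hbeq (ne_of_lt ?_)
    unfold diskBump at hl hne ⊢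
    apply Real.smoothTransition_lt_of_lt
    · rw [hsq]
      have : sqLength v < u ^ 2 * sqLength v :=
        lt_mul_of_one_lt_left hQ (one_lt_pow₀ hu1 two_ne_zero)
      gcongr
    · rwa [Ne, Real.smoothTransition.zero_iff_nonpos, not_le] at hl
    · rwa [Real.smoothTransition.eq_one_iff_one_le, not_le] at hne
  -- On the plateau of the `l`-th ball the period is exactly `m l`.
  have hln : m l = m n := by
    rw [← hper, minimalPeriod_diskTwist hm0 hone (ha l) hz]
  obtain rfl := hinj hln
  have := diskHeight_pos l
  exact (norm_lt_of_diskBump_ne_zero hl).trans (by linarith)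

end Period

end Twist

/-! ### Smoothness of the infinite twist -/

/-- A smooth one-parameter family of maps with common compact support that vanishes for the
parameter `0` is uniformly small, with its derivatives, for small parameters. -/
theorem eventually_norm_iteratedFDeriv_le {Z V : Type*} [NormedAddCommGroup Z] [NormedSpace ℝ Z]
    [NormedAddCommGroup V] [NormedSpace ℝ V] {v : ℝ × Z → V} (hv : ContDiff ℝ ∞ v) {K : Set Z}
    (hK : IsCompact K) (hKv : ∀ θ, ∀ z ∉ K, v (θ, z) = 0) (h0 : ∀ z, v (0, z) = 0) (k : ℕ)
    {ε : ℝ} (hε : 0 < ε) :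
    ∀ᶠ θ in 𝓝 (0 : ℝ), ∀ j ≤ k, ∀ z, ‖iteratedFDeriv ℝ j (fun z => v (θ, z)) z‖ ≤ ε := by
  refine (eventually_all_finite (finite_Iic k)).2 fun j _ => ?_
  have hc : Continuous fun q : ℝ × Z => iteratedFDeriv ℝ j (fun z => v (q.1, z)) q.2 := by
    rw [continuous_iff_continuousAt]
    rintro ⟨θ, z⟩
    have h := ContDiffWithinAt.continuousWithinAt_iteratedFDerivWithin_snd (P := ℝ) (a := θ)
      (x := z) (s := univ) (j := j) uniqueDiffOn_univ (mem_univ _)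
      ((hv.of_le (by exact_mod_cast le_top)).contDiffAt.contDiffWithinAt)
    simpa only [univ_prod_univ, continuousWithinAt_univ, iteratedFDerivWithin_univ] using h
  have hK' : ∀ᶠ θ in 𝓝 (0 : ℝ), ∀ z ∈ K, ‖iteratedFDeriv ℝ j (fun z => v (θ, z)) z‖ < ε := by
    refine hK.eventually_forall_of_forall_eventually fun z _ => ?_
    refine hc.norm.continuousAt.eventually (isOpen_Iio.mem_nhds ?_)
    have : (fun z => v (0, z)) = 0 := funext h0
    simp [this, hε]
  filter_upwards [hK'] with θ hθ z
  by_cases hz : z ∈ K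
  · exact (hθ z hz).le
  · have : (fun z => v (θ, z)) =ᶠ[𝓝 z] fun _ => 0 := by
      filter_upwards [hK.isClosed.isOpen_compl.mem_nhds hz] with y hy
      exact hKv θ y hy
    rw [(this.iteratedFDeriv ℝ j).self_of_nhds, iteratedFDeriv_fun_zero]
    simpa using hε.le

section Smoothness

variable {W : Type*} [NormedAddCommGroup W] [InnerProductSpace ℝ W]

theorem contDiff_sqLength : ContDiff ℝ ∞ (sqLength : ℂ × W → ℝ) := by
  have : (sqLength : ℂ × W → ℝ) = fun x => ‖x.1‖ ^ 2 + ‖x.2‖ ^ 2 := by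
    funext x; rw [sqLength, Complex.normSq_eq_norm_sq]
  rw [this]
  exact (contDiff_fst.norm_sq ℝ).add (contDiff_snd.norm_sq ℝ)

theorem contDiff_diskBump (n : ℕ) : ContDiff ℝ ∞ (diskBump n : ℂ × W → ℝ) :=
  Real.smoothTransition.contDiff.comp (contDiff_const.sub (contDiff_sqLength.div_const _))

theorem contDiff_positionCutoff : ContDiff ℝ ∞ positionCutoff :=
  Real.smoothTransition.contDiff.comp (contDiff_const.sub (contDiff_id.pow 2))

theorem contDiff_rotFst : ContDiff ℝ ∞ fun q : ℝ × (ℂ × W) => rotFst q.1 q.2 := by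
  unfold rotFst
  have h : ContDiff ℝ ∞ fun q : ℝ × (ℂ × W) => (q.1 : ℂ) :=
    Complex.ofRealCLM.contDiff.comp contDiff_fst
  exact ((h.mul contDiff_const).cexp.mul (by fun_prop)).prodMk (by fun_prop)

theorem contDiff_twistDisplacement (n : ℕ) :
    ContDiff ℝ ∞ fun q : ℝ × (ℝ × (ℂ × W)) => twistDisplacement n q.1 q.2.1 q.2.2 := by
  have h1 : ContDiff ℝ ∞ fun q : ℝ × (ℝ × (ℂ × W)) => q.2.2 - diskCenter W n q.2.1 := by
    unfold diskCenter
    have h : ContDiff ℝ ∞ fun q : ℝ × (ℝ × (ℂ × W)) => (q.2.1 : ℂ) :=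
      Complex.ofRealCLM.contDiff.comp (contDiff_fst.comp contDiff_snd)
    exact ContDiff.sub (by fun_prop) ((h.add contDiff_const).prodMk contDiff_const)
  have h2 : ContDiff ℝ ∞ fun q : ℝ × (ℝ × (ℂ × W)) => positionCutoff q.2.1 :=
    contDiff_positionCutoff.comp (contDiff_fst.comp contDiff_snd)
  unfold twistDisplacement
  exact (contDiff_rotFst.comp ((contDiff_fst.mul
    (h2.mul ((contDiff_diskBump n).comp h1))).prodMk h1)).sub h1

/-- The displacement vanishes for `θ = 0` and has a common compact support in `(t, x)`. Here `n` is
both the disk and the highest order of derivative controlled. -/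
theorem exists_forall_norm_iteratedFDeriv_twistDisplacement_le [FiniteDimensional ℝ W] (n : ℕ)
    {ε : ℝ} (hε : 0 < ε) : ∃ δ > 0, ∀ θ : ℝ, |θ| ≤ δ → ∀ j ≤ n, ∀ z : ℝ × (ℂ × W),
      ‖iteratedFDeriv ℝ j (fun z : ℝ × (ℂ × W) => twistDisplacement n θ z.1 z.2) z‖ ≤ ε := by
  have h := eventually_norm_iteratedFDeriv_le (contDiff_twistDisplacement (W := W) n)
    (isCompact_closedBall (0 : ℝ × (ℂ × W)) 4) ?_ ?_ n hε
  · obtain ⟨δ, hδ, h⟩ := Metric.eventually_nhds_iff.1 h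
    refine ⟨δ / 2, half_pos hδ, fun θ hθ => h ?_⟩
    rw [Real.dist_eq, sub_zero]
    linarith
  · intro θ z hz
    by_contra h
    obtain ⟨h1, h2⟩ := twistDisplacement_support h
    apply hz
    rw [mem_closedBall_zero_iff, Prod.norm_def, max_le_iff]
    exact ⟨by rw [Real.norm_eq_abs]; linarith, h2.le⟩
  · intro z
    simp [twistDisplacement]

/-- For rapidly decreasing angles, the twist map is smooth jointly in the point and in a parameter
that determines the positions of the disks through continuous linear functionals. -/
theorem exists_forall_contDiff_diskTwist [FiniteDimensional ℝ W] {P : Type*}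
    [NormedAddCommGroup P] [NormedSpace ℝ P] (c : ℕ → P →L[ℝ] ℝ) :
    ∃ δ : ℕ → ℝ, (∀ n, 0 < δ n) ∧ ∀ θ : ℕ → ℝ, (∀ n, |θ n| ≤ δ n) →
      ContDiff ℝ ∞ fun q : P × (ℂ × W) => diskTwist θ (fun n => c n q.1) q.2 := by
  obtain ⟨L, hL⟩ : ∃ L : ℕ → P × (ℂ × W) →L[ℝ] ℝ × (ℂ × W), ∀ n q, L n q = (c n q.1, q.2) :=
    ⟨fun n => (c n).prodMap (ContinuousLinearMap.id ℝ (ℂ × W)), fun _ _ => rfl⟩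
  obtain ⟨C, hC, hLC⟩ : ∃ C : ℕ → ℝ, (∀ n, 1 ≤ C n) ∧ ∀ n, ‖L n‖ ≤ C n :=
    ⟨fun n => max 1 ‖L n‖, fun _ => le_max_left _ _, fun _ => le_max_right _ _⟩
  have hC0 : ∀ n, 0 < C n ^ n := fun n => pow_pos (one_pos.trans_le (hC n)) n
  -- Composing with `L n` multiplies a `k`-th derivative by at most `‖L n‖ ^ k ≤ C n ^ n` for `k ≤
  -- n`, because `1 ≤ C n`; the tolerance absorbs this factor.
  choose δ hδ h using fun n => exists_forall_norm_iteratedFDeriv_twistDisplacement_le (W := W) n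
    (div_pos (by positivity) (hC0 n) : 0 < (1 / 2 : ℝ) ^ n / C n ^ n)
  refine ⟨δ, hδ, fun θ hθ => ?_⟩
  have hsm : ∀ n, ContDiff ℝ ∞ fun z : ℝ × (ℂ × W) => twistDisplacement n (θ n) z.1 z.2 :=
    fun n => (contDiff_twistDisplacement n).comp (contDiff_const.prodMk contDiff_id)
  have hcomp : ∀ n, (fun q : P × (ℂ × W) => twistDisplacement n (θ n) (c n q.1) q.2) =
      (fun z : ℝ × (ℂ × W) => twistDisplacement n (θ n) z.1 z.2) ∘ L n := fun n => by
    funext q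
    rw [Function.comp_apply, hL]
  have hbound : ∀ n, ∀ k ≤ n, ∀ q, ‖iteratedFDeriv ℝ k
      (fun q : P × (ℂ × W) => twistDisplacement n (θ n) (c n q.1) q.2) q‖ ≤ (1 / 2) ^ n := by
    intro n k hk q
    rw [hcomp, (L n).iteratedFDeriv_comp_right (hsm n) q (by exact_mod_cast le_top)]
    refine (ContinuousMultilinearMap.norm_compContinuousLinearMap_le _ _).trans ?_
    rw [Finset.prod_const, Finset.card_univ, Fintype.card_fin]
    have h1 : ‖L n‖ ^ k ≤ C n ^ n :=
      (pow_le_pow_left₀ (norm_nonneg (L n)) (hLC n) k).trans (pow_le_pow_right₀ (hC n) hk)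
    refine (mul_le_mul (h n (θ n) (hθ n) k hk _) h1 (by positivity)
      (div_nonneg (by positivity) (hC0 n).le)).trans_eq ?_
    exact div_mul_cancel₀ _ (hC0 n).ne'
  have hsum : ContDiff ℝ ∞ fun q : P × (ℂ × W) =>
      ∑' n, twistDisplacement n (θ n) (c n q.1) q.2 := by
    refine contDiff_tsum_of_eventually (N := ⊤) (v := fun _ n => (1 / 2) ^ n)
      (fun n => ?_) (fun _ _ => summable_geometric_two) fun k _ => ?_
    · rw [hcomp]
      exact (hsm n).comp (L n).contDiff
    -- For each order `k`, the bound is only needed for all but finitely many `n`, so `k ≤ n`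
    -- suffices.
    · rw [Nat.cofinite_eq_atTop]
      filter_upwards [eventually_ge_atTop k] with n hn q
      exact hbound n k hn q
  exact contDiff_snd.add hsum

end Smoothness

/-! ### Choice of periods and of a parameter space -/

/-- There are strictly increasing periods growing faster than any given rate. -/
theorem exists_strictMono_two_pi_div_le {δ : ℕ → ℝ} (hδ : ∀ n, 0 < δ n) :
    ∃ m : ℕ → ℕ, StrictMono m ∧ ∀ n, 2 ≤ m n ∧ 2 * Real.pi / m n ≤ δ n := by
  refine extraction_forall_of_eventually
    (P := fun n k => 2 ≤ k ∧ 2 * Real.pi / (k : ℝ) ≤ δ n) fun n => ?_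
  have h : Tendsto (fun k : ℕ => 2 * Real.pi / (k : ℝ)) atTop (𝓝 0) :=
    tendsto_const_div_atTop_nhds_zero_nat _
  exact (eventually_ge_atTop 2).and ((h.eventually (gt_mem_nhds (hδ n))).mono fun _ h => h.le)

open scoped BoundedContinuousFunction in
/-- The Hilbert cube embeds into a normed space in such a way that the coordinates are given by
continuous linear functionals. -/
theorem exists_continuous_cube_embedding : ∃ (ι : (ℕ → I) → (ℕ →ᵇ ℝ))
    (c : ℕ → (ℕ →ᵇ ℝ) →L[ℝ] ℝ), Continuous ι ∧ ∀ α n, c n (ι α) = α n := by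
  have hbd : ∀ (α : ℕ → I) n, ‖(1 / 2 : ℝ) ^ n * α n‖ ≤ (1 / 2) ^ n := fun α n => by
    rw [norm_mul, Real.norm_of_nonneg (by positivity), Real.norm_of_nonneg (α n).2.1]
    exact mul_le_of_le_one_right (by positivity) (α n).2.2
  -- The weights `2⁻ⁿ` make the product topology control the sup norm; the functionals undo them.
  let ι : (ℕ → I) → (ℕ →ᵇ ℝ) := fun α =>
    BoundedContinuousFunction.ofNormedAddCommGroupDiscrete (fun n => (1 / 2 : ℝ) ^ n * α n) 1
      fun n => (hbd α n).trans (pow_le_one₀ (by norm_num) (by norm_num))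
  refine ⟨ι, fun n => (2 : ℝ) ^ n • BoundedContinuousFunction.evalCLM ℝ n, ?_, ?_⟩
  · rw [continuous_iff_continuousAt]
    intro α
    rw [Metric.continuousAt_iff']
    intro ε hε
    obtain ⟨N, hN⟩ := exists_pow_lt_of_lt_one (half_pos hε) (by norm_num : (1 / 2 : ℝ) < 1)
    have hnear : ∀ᶠ β in 𝓝 α, ∀ n ∈ Iio N, dist (β n) (α n) < ε / 2 := by
      refine (eventually_all_finite (finite_Iio N)).2 fun n _ => ?_
      exact Metric.continuousAt_iff'.1 (continuous_apply n).continuousAt _ (half_pos hε)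
    filter_upwards [hnear] with β hβ
    refine ((BoundedContinuousFunction.dist_le (half_pos hε).le).2 fun n => ?_).trans_lt
      (half_lt_self hε)
    have hd : dist (ι β n) (ι α n) = (1 / 2 : ℝ) ^ n * dist (β n) (α n) := by
      rw [Subtype.dist_eq, Real.dist_eq, Real.dist_eq]
      change |(1 / 2 : ℝ) ^ n * β n - (1 / 2 : ℝ) ^ n * α n| = _
      rw [← mul_sub, abs_mul, abs_of_pos (by positivity)]
    rw [hd]
    rcases lt_or_ge n N with h | h
    · exact (mul_le_of_le_one_left dist_nonneg
        (pow_le_one₀ (by norm_num) (by norm_num))).trans (hβ n h).le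
    · have h1 : dist (β n) (α n) ≤ 1 := by
        rw [Subtype.dist_eq]
        exact (Real.dist_le_of_mem_Icc_01 (β n).2 (α n).2)
      exact (mul_le_of_le_one_right (by positivity) h1).trans
        ((pow_le_pow_of_le_one (by norm_num) (by norm_num) h).trans hN.le)
  · intro α n
    change (2 : ℝ) ^ n * ((1 / 2 : ℝ) ^ n * α n) = α n
    rw [← mul_assoc, ← mul_pow]
    norm_num

/-! ### Sliding the balls horizontally -/

/-- A continuous shear in the direction `e` whose amount is `1 / 2`-Lipschitz in this direction
is a homeomorphism. -/
theorem exists_homeomorph_shear {V : Type*} [NormedAddCommGroup V] [NormedSpace ℝ V] {g : V → ℝ}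
    (hg : Continuous g) (e : V)
    (hlip : ∀ x s t, |g (x + s • e) - g (x + t • e)| ≤ |s - t| / 2) :
    ∃ h : V ≃ₜ V, ∀ x, h x = x + g x • e := by
  -- To invert `y = x + g x • e`, solve `t = g (y - t • e)` for `t = g x`: a fixed point of a
  -- contraction.
  have hcontr : ∀ y, ContractingWith (1 / 2) fun t : ℝ => g (y - t • e) := by
    refine fun y => ⟨by norm_num, LipschitzWith.of_dist_le_mul fun s t => ?_⟩
    have := hlip y (-s) (-t)
    rw [neg_smul, neg_smul, ← sub_eq_add_neg, ← sub_eq_add_neg, neg_sub_neg, abs_sub_comm t] at this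
    rw [Real.dist_eq, Real.dist_eq]
    push_cast
    linarith
  choose τ hτ using fun y => (⟨_, (hcontr y).fixedPoint_isFixedPt⟩ :
    ∃ t : ℝ, g (y - t • e) = t)
  have huniq : ∀ y t, g (y - t • e) = t → t = τ y := fun y t ht =>
    (hcontr y).fixedPoint_unique' ht (hτ y)
  have hτc : Continuous τ := by
    rw [continuous_iff_continuousAt]
    intro y
    -- By the triangle inequality through `g (y' - τ y • e)`, half of the left side is absorbed by
    -- the contraction.
    have hbound : ∀ y', |τ y' - τ y| ≤ 2 * |g (y' - τ y • e) - g (y - τ y • e)| := by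
      intro y'
      have h1 := (hcontr y').2.dist_le_mul (τ y') (τ y)
      rw [Real.dist_eq, Real.dist_eq] at h1
      push_cast at h1
      have h2 := abs_sub_le (g (y' - τ y' • e)) (g (y' - τ y • e)) (g (y - τ y • e))
      rw [hτ y, hτ y'] at *
      linarith
    have hlim : Tendsto (fun y' => 2 * |g (y' - τ y • e) - g (y - τ y • e)|) (𝓝 y) (𝓝 0) := by
      have : Continuous fun y' => 2 * |g (y' - τ y • e) - g (y - τ y • e)| := by fun_prop
      simpa using this.tendsto y
    rw [ContinuousAt, tendsto_iff_norm_sub_tendsto_zero]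
    exact squeeze_zero (fun _ => norm_nonneg _) hbound hlim
  refine ⟨⟨⟨fun x => x + g x • e, fun y => y - τ y • e, fun x => ?_, fun y => ?_⟩, by fun_prop,
    by fun_prop⟩, fun x => rfl⟩
  · have : g x = τ (x + g x • e) := huniq _ _ (by rw [add_sub_cancel_right])
    simp only [← this, add_sub_cancel_right]
  · simp only [hτ, sub_add_cancel]

noncomputable section Slide

variable {W : Type*} [NormedAddCommGroup W]

/-- A tent function supported in the `n`-th strip. -/
def stripTent (n : ℕ) (y : ℝ) : ℝ := min 1 (max 0 (4 - 12 * |y - diskHeight n| / diskHeight n))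

theorem stripTent_nonneg (n : ℕ) (y : ℝ) : 0 ≤ stripTent n y :=
  le_min zero_le_one (le_max_left _ _)

theorem stripTent_le_one (n : ℕ) (y : ℝ) : stripTent n y ≤ 1 := min_le_left _ _

theorem continuous_stripTent (n : ℕ) : Continuous (stripTent n) := by
  unfold stripTent; fun_prop

/-- The constants `4` and `12` give the value `1` within a quarter of the height, where the bump
lives, and `0` beyond a third, where strips could meet. -/
theorem stripTent_eq_one {n : ℕ} {y : ℝ} (h : |y - diskHeight n| < diskHeight n / 4) :
    stripTent n y = 1 := by
  have hn := diskHeight_pos n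
  refine min_eq_left (le_max_of_le_right ?_)
  have : 12 * |y - diskHeight n| / diskHeight n ≤ 3 := by
    rw [div_le_iff₀ hn]; linarith
  linarith

theorem abs_lt_of_stripTent_ne_zero {n : ℕ} {y : ℝ} (h : stripTent n y ≠ 0) :
    |y - diskHeight n| < diskHeight n / 3 := by
  have hn := diskHeight_pos n
  by_contra! h'
  refine h ?_
  have : 4 ≤ 12 * |y - diskHeight n| / diskHeight n := by
    rw [le_div_iff₀ hn]; linarith
  rw [stripTent, max_eq_left (by linarith)]
  exact min_eq_right zero_le_one

/-- The function that takes the value `s n` in the middle of the `n`-th strip. -/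
def stripInterpolation (s : ℕ → ℝ) (y : ℝ) : ℝ := ∑' n, s n * stripTent n y

theorem stripInterpolation_eq {s : ℕ → ℝ} {n : ℕ} {y : ℝ} (h : stripTent n y ≠ 0) :
    stripInterpolation s y = s n * stripTent n y := by
  refine tsum_eq_single n fun m hm => ?_
  by_contra h'
  exact hm (eq_of_mem_strips (abs_lt_of_stripTent_ne_zero (right_ne_zero_of_mul h'))
    (abs_lt_of_stripTent_ne_zero h))

theorem stripInterpolation_eq_zero {s : ℕ → ℝ} {y : ℝ} (h : ∀ n, stripTent n y = 0) :
    stripInterpolation s y = 0 := by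
  simp [stripInterpolation, h]

theorem abs_stripInterpolation_le {s : ℕ → ℝ} {ε : ℝ} (hε : 0 ≤ ε) (hs : ∀ n, |s n| ≤ ε) (y : ℝ) :
    |stripInterpolation s y| ≤ ε := by
  by_cases h : ∀ n, stripTent n y = 0
  · rwa [stripInterpolation_eq_zero h, abs_zero]
  · push Not at h
    obtain ⟨n, hn⟩ := h
    rw [stripInterpolation_eq hn, abs_mul, abs_of_nonneg (stripTent_nonneg n y)]
    exact (mul_le_of_le_one_right (abs_nonneg _) (stripTent_le_one n y)).trans (hs n)

theorem stripInterpolation_sub (s t : ℕ → ℝ) (y : ℝ) :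
    stripInterpolation s y - stripInterpolation t y = stripInterpolation (s - t) y := by
  by_cases h : ∀ n, stripTent n y = 0
  · simp [stripInterpolation_eq_zero h]
  · push Not at h
    obtain ⟨n, hn⟩ := h
    simp [stripInterpolation_eq hn, sub_mul]

/-- Disjointness of the strips bounds the sup norm of a tail by the supremum of the `|s n|` in it.
So `s → 0` makes the sum a uniform limit of finite sums, continuous also at height `0`. -/
theorem continuous_stripInterpolation {s : ℕ → ℝ} (hs : Tendsto s atTop (𝓝 0)) :
    Continuous (stripInterpolation s) := by
  refine continuous_of_uniform_approx_of_continuous fun u hu => ?_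
  obtain ⟨ε, hε, hεu⟩ := Metric.mem_uniformity_dist.1 hu
  obtain ⟨N, hN⟩ := Metric.tendsto_atTop.1 hs (ε / 2) (half_pos hε)
  let t : ℕ → ℝ := fun n => if n < N then s n else 0
  have ht : stripInterpolation t = fun y => ∑ n ∈ Finset.range N, s n * stripTent n y := by
    funext y
    rw [stripInterpolation, tsum_eq_sum (s := Finset.range N)]
    · refine Finset.sum_congr rfl fun n hn => ?_
      simp only [t, if_pos (Finset.mem_range.1 hn)]
    · intro n hn
      simp only [t, if_neg (fun h => hn (Finset.mem_range.2 h)), zero_mul]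
  refine ⟨stripInterpolation t, ?_, fun y => ?_⟩
  · rw [ht]
    exact continuous_finsetSum _ fun n _ => continuous_const.mul (continuous_stripTent n)
  · refine hεu ?_
    rw [Real.dist_eq, stripInterpolation_sub]
    refine (abs_stripInterpolation_le (half_pos hε).le (fun n => ?_) y).trans_lt (half_lt_self hε)
    by_cases hn : n < N
    · simp [t, hn, (half_pos hε).le]
    · have := hN n (not_lt.1 hn)
      rw [Real.dist_eq, sub_zero] at this
      simpa [t, hn] using this.le

/-- The amount by which a point is moved when the `n`-th disk is moved by `s n`. -/
def slideAmount (s : ℕ → ℝ) (x : ℂ × W) : ℝ :=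
  stripInterpolation s x.1.im * min 1 (max 0 (2 - ‖x.2‖)) * min 1 (max 0 (2 - |x.1.re| / 2))

theorem continuous_slideAmount {s : ℕ → ℝ} (hs : Tendsto s atTop (𝓝 0)) :
    Continuous (slideAmount s : ℂ × W → ℝ) := by
  unfold slideAmount
  have h := (continuous_stripInterpolation hs).comp
    (Complex.continuous_im.comp (continuous_fst : Continuous (Prod.fst : ℂ × W → ℂ)))
  have h' := Complex.continuous_re.comp (continuous_fst : Continuous (Prod.fst : ℂ × W → ℂ))
  have h'' : Continuous fun x : ℂ × W => |x.1.re| := h'.abs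
  exact (h.mul (by fun_prop)).mul (by fun_prop)

/-- Only the last factor varies along the real direction, with slope at most `1/2`; the other two
are bounded by `1`. -/
theorem abs_slideAmount_sub_le [NormedSpace ℝ W] {s : ℕ → ℝ} (hs : ∀ n, |s n| ≤ 1) (x : ℂ × W)
    (t u : ℝ) :
    |slideAmount s (x + t • ((1 : ℂ), (0 : W))) - slideAmount s (x + u • ((1 : ℂ), (0 : W)))| ≤
      |t - u| / 2 := by
  have h1 : |stripInterpolation s x.1.im| ≤ 1 := abs_stripInterpolation_le zero_le_one hs _
  have h2 : |min 1 (max 0 (2 - ‖x.2‖))| ≤ 1 := by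
    rw [abs_of_nonneg (le_min zero_le_one (le_max_left _ _))]
    exact min_le_left _ _
  have h3 : |min 1 (max 0 (2 - |x.1.re + t| / 2)) - min 1 (max 0 (2 - |x.1.re + u| / 2))| ≤
      |t - u| / 2 := by
    have e1 := abs_min_sub_min_le_max 1 (max 0 (2 - |x.1.re + t| / 2)) 1
      (max 0 (2 - |x.1.re + u| / 2))
    have e2 := abs_max_sub_max_le_max 0 (2 - |x.1.re + t| / 2) 0 (2 - |x.1.re + u| / 2)
    rw [sub_self, abs_zero, max_eq_right (a := (0 : ℝ)) (abs_nonneg (_ - _))] at e1 e2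
    have e3 := abs_abs_sub_abs_le_abs_sub (x.1.re + t) (x.1.re + u)
    have e4 : 2 - |x.1.re + t| / 2 - (2 - |x.1.re + u| / 2) =
      -(|x.1.re + t| - |x.1.re + u|) / 2 := by ring
    rw [e4, abs_div, abs_neg, abs_two] at e2
    rw [add_sub_add_left_eq_sub] at e3
    linarith
  simp only [slideAmount, Prod.fst_add, Prod.snd_add, Prod.smul_fst, Prod.smul_snd, smul_zero,
    add_zero, Complex.add_im, Complex.add_re, Complex.real_smul, mul_one, Complex.ofReal_im,
    Complex.ofReal_re]
  rw [← mul_sub, abs_mul, abs_mul]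
  exact (mul_le_of_le_one_left (abs_nonneg _)
    (mul_le_one₀ h1 (abs_nonneg _) h2)).trans h3

theorem slideAmount_of_diskBump_ne_zero {s : ℕ → ℝ} {n : ℕ} {t : ℝ} (ht : t ∈ Icc (0 : ℝ) 1)
    {x : ℂ × W} (h : diskBump n (x - diskCenter W n t) ≠ 0) : slideAmount s x = s n := by
  have h0 := stripTent_eq_one (abs_im_lt_of_diskBump_ne_zero h)
  have h1 := norm_lt_of_diskBump_ne_zero h
  have h2 := diskHeight_le_one n
  have h3 : ‖x.2‖ ≤ 1 := by
    have := norm_snd_le (x - diskCenter W n t)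
    simp only [diskCenter, Prod.snd_sub, sub_zero] at this
    simp only [diskCenter] at h1
    linarith
  have h4 : |x.1.re| ≤ 2 := by
    have e1 := (Complex.abs_re_le_norm _).trans (norm_fst_le (x - diskCenter W n t))
    have e2 := e1.trans_lt h1
    simp [diskCenter] at e2
    rw [abs_lt] at e2
    rw [abs_le]
    constructor <;> linarith [ht.1, ht.2]
  rw [slideAmount, stripInterpolation_eq (n := n) (by rw [h0]; exact one_ne_zero), h0,
    min_eq_left (le_max_of_le_right (by linarith)),
    min_eq_left (le_max_of_le_right (by linarith)), mul_one, mul_one, mul_one]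

theorem slideAmount_of_six_le_norm {s : ℕ → ℝ} {x : ℂ × W} (hx : 6 ≤ ‖x‖) :
    slideAmount s x = 0 := by
  by_contra h
  have h1 : ‖x.2‖ < 2 := by
    by_contra! h'
    apply h
    rw [slideAmount, max_eq_left (by linarith : 2 - ‖x.2‖ ≤ 0), min_eq_right zero_le_one]
    ring
  have h2 : |x.1.re| < 4 := by
    by_contra! h'
    apply h
    rw [slideAmount, max_eq_left (by linarith : 2 - |x.1.re| / 2 ≤ 0), min_eq_right zero_le_one]
    ring
  have h3 : |x.1.im| < 2 := by
    by_contra! h'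
    apply h
    rw [slideAmount, stripInterpolation_eq_zero, zero_mul, zero_mul]
    intro n
    by_contra hn
    have e1 := abs_lt_of_stripTent_ne_zero hn
    have e2 := diskHeight_le_one n
    have e3 := diskHeight_pos n
    have e4 : |x.1.im| ≤ |x.1.im - diskHeight n| + |diskHeight n| := by
      simpa using abs_add_le (x.1.im - diskHeight n) (diskHeight n)
    rw [abs_of_pos e3] at e4
    linarith
  have h4 := Complex.norm_le_abs_re_add_abs_im x.1
  have h5 : ‖x‖ < 6 := by
    rw [Prod.norm_def, max_lt_iff]
    constructor <;> linarith
  linarith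

/-- Twist maps for asymptotic sequences of positions are conjugate by a homeomorphism with compact
support. -/
theorem exists_homeomorph_conj_diskTwist [NormedSpace ℝ W] (θ : ℕ → ℝ) {a b : ℕ → ℝ}
    (ha : ∀ n, a n ∈ Icc (0 : ℝ) 1) (hb : ∀ n, b n ∈ Icc (0 : ℝ) 1)
    (hab : Tendsto (fun n => b n - a n) atTop (𝓝 0)) :
    ∃ h : (ℂ × W) ≃ₜ (ℂ × W), (∀ x, 6 ≤ ‖x‖ → h x = x) ∧
      ∀ x, h (diskTwist θ a x) = diskTwist θ b (h x) := by
  set s : ℕ → ℝ := fun n => b n - a n with hs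
  have hs1 : ∀ n, |s n| ≤ 1 := fun n => by
    rw [abs_le]
    constructor <;> linarith [(ha n).1, (ha n).2, (hb n).1, (hb n).2]
  obtain ⟨h, hh⟩ := exists_homeomorph_shear (continuous_slideAmount (W := W) hab)
    ((1 : ℂ), (0 : W)) (abs_slideAmount_sub_le hs1)
  have hcenter : ∀ n, diskCenter W n (b n) = diskCenter W n (a n) + s n • ((1 : ℂ), (0 : W)) := by
    intro n
    simp only [diskCenter, hs]
    ext1
    · simp only [Prod.fst_add, Prod.smul_fst, Complex.real_smul]
      push_cast
      ring
    · simp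
  have hmove : ∀ n x, diskBump n (x - diskCenter W n (a n)) ≠ 0 →
      h x - diskCenter W n (b n) = x - diskCenter W n (a n) := by
    intro n x hx
    rw [hh, slideAmount_of_diskBump_ne_zero (ha n) hx, hcenter]
    abel
  refine ⟨h, fun x hx => by rw [hh, slideAmount_of_six_le_norm hx, zero_smul, add_zero],
    fun x => ?_⟩
  by_cases hx : ∀ n, diskBump n (x - diskCenter W n (a n)) = 0
  · rw [diskTwist_of_forall_diskBump_eq_zero θ hx, diskTwist_of_forall_diskBump_eq_zero θ]
    intro n
    by_contra hn
    -- If `h x` lay in the `n`-th ball for `b`, its translate `x'` in the ball for `a` would have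
    -- the same image, so `x = x'` by injectivity.
    set x' := h x - diskCenter W n (b n) + diskCenter W n (a n) with hx'
    have e1 : diskBump n (x' - diskCenter W n (a n)) ≠ 0 := by
      rwa [hx', add_sub_cancel_right]
    have e2 := hmove n x' e1
    rw [hx', add_sub_cancel_right, ← hx', sub_left_inj] at e2
    rw [h.injective e2] at e1
    exact e1 (hx n)
  · push Not at hx
    obtain ⟨n, hn⟩ := hx
    have e1 : diskBump n (diskTwist θ a x - diskCenter W n (a n)) ≠ 0 := by
      rwa [diskTwist_sub_diskCenter θ hn, diskBump_rotFst]
    have e2 := hmove n _ e1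
    have e3 := hmove n _ hn
    have e4 : diskBump n (h x - diskCenter W n (b n)) ≠ 0 := by rwa [e3]
    rw [← sub_left_inj (a := diskCenter W n (b n)), e2, diskTwist_sub_diskCenter θ hn,
      diskTwist_sub_diskCenter θ e4, e3, positionCutoff_of_mem_Icc (ha n),
      positionCutoff_of_mem_Icc (hb n)]

end Slide

/-! ### A large ball in a chart, and extension by the identity -/

/-- A nonempty manifold, possibly with boundary or corners, has a chart whose image contains a
ball of the model vector space. -/
theorem exists_openPartialHomeomorph_closedBall_subset {E V : Type*} [NormedAddCommGroup E]
    [NormedSpace ℝ E] [NormedAddCommGroup V] [NormedSpace ℝ V] (A : E ≃L[ℝ] V)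
    {H : Type*} [TopologicalSpace H] (J : ModelWithCorners ℝ E H)
    (M : Type*) [TopologicalSpace M] [ChartedSpace H M] [IsManifold J ∞ M] [Nonempty M] (R : ℝ) :
    ∃ e : OpenPartialHomeomorph M V, Metric.closedBall 0 R ⊆ e.target ∧
      ContMDiffOn J 𝓘(ℝ, V) ∞ e e.source ∧ ContMDiffOn 𝓘(ℝ, V) J ∞ e.symm e.target := by
  obtain ⟨x₀⟩ := ‹Nonempty M›
  set φ := chartAt H x₀
  have hφ : φ ∈ IsManifold.maximalAtlas J ∞ M := IsManifold.chart_mem_maximalAtlas x₀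
  have hx₀ : x₀ ∈ φ.source := mem_chart_source H x₀
  have hT : (φ.extend J).target ∩ interior (range J) = J.symm ⁻¹' φ.target ∩ interior (range J) := by
    rw [φ.extend_target, inter_assoc, inter_eq_right.2 interior_subset]
  have hopen : IsOpen ((φ.extend J).target ∩ interior (range J)) := by
    rw [hT]
    exact (φ.open_target.preimage J.continuous_symm).inter isOpen_interior
  -- Restricting to the interior of `range J` discards boundary and corners; what remains is
  -- nonempty since `range J` lies in the closure of its interior.
  let e₀ : OpenPartialHomeomorph M E :=
    { toPartialEquiv := ((φ.extend J).symm.restr (interior (range J))).symm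
      open_source := φ.continuousOn_extend.isOpen_inter_preimage φ.isOpen_extend_source
        isOpen_interior
      open_target := hopen
      continuousOn_toFun := φ.continuousOn_extend.mono inter_subset_left
      continuousOn_invFun := φ.continuousOn_extend_symm.mono inter_subset_left }
  obtain ⟨q, hq⟩ : ((φ.extend J).target ∩ interior (range J)).Nonempty := by
    rw [hT]
    have h1 : φ.extend J x₀ ∈ closure (interior (range J)) :=
      J.range_subset_closure_interior (mem_range_self _)
    refine mem_closure_iff.1 h1 _ (φ.open_target.preimage J.continuous_symm) ?_
    simp [φ.map_source hx₀]
  obtain ⟨ρ, hρ, hball⟩ := Metric.isOpen_iff.1 hopen q hq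
  -- The scale `c` shrinks the image of the `R`-ball into the `ρ`-ball around `q`; `|R| + 1` avoids
  -- a sign condition on `R`.
  obtain ⟨c, hc, hcR⟩ : ∃ c : ℝ, 0 < c ∧ c * (‖(A.symm : V →L[ℝ] E)‖ * (|R| + 1)) < ρ := by
    refine ⟨ρ / (‖(A.symm : V →L[ℝ] E)‖ * (|R| + 1) + 1), by positivity, ?_⟩
    rw [div_mul_eq_mul_div, div_lt_iff₀ (by positivity)]
    nlinarith
  let B : E ≃ₜ V :=
    { toFun := fun x => c⁻¹ • A (x - q)
      invFun := fun y => q + c • A.symm y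
      left_inv := fun x => by simp [smul_smul, hc.ne']
      right_inv := fun y => by simp [smul_smul, hc.ne']
      continuous_toFun := by fun_prop
      continuous_invFun := by fun_prop }
  refine ⟨e₀.transHomeomorph B, ?_, ?_, ?_⟩
  · intro y hy
    change q + c • A.symm y ∈ (φ.extend J).target ∩ interior (range J)
    apply hball
    rw [Metric.mem_ball, dist_self_add_left, norm_smul, Real.norm_of_nonneg hc.le]
    refine lt_of_le_of_lt ?_ hcR
    have h1 : ‖A.symm y‖ ≤ ‖(A.symm : V →L[ℝ] E)‖ * ‖y‖ :=
      (A.symm : V →L[ℝ] E).le_opNorm y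
    have h2 : ‖y‖ ≤ |R| + 1 := by
      have := mem_closedBall_zero_iff.1 hy
      linarith [le_abs_self R]
    gcongr
    exact h1.trans (by gcongr)
  · have hB : ContDiff ℝ ∞ fun x => c⁻¹ • A (x - q) := by fun_prop
    exact hB.contMDiff.comp_contMDiffOn ((φ.contMDiffOn_extend hφ).mono fun x hx => by
      have h : x ∈ (φ.extend J).source := hx.1
      rwa [φ.extend_source] at h)
  · have hB : ContDiff ℝ ∞ fun y => q + c • A.symm y := by fun_prop
    have h := contMDiffOn_extend_symm hφ
    rw [← φ.extend_target'] at h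
    exact h.comp hB.contMDiff.contMDiffOn fun y hy => hy.1

section Extension

variable {V : Type*} [NormedAddCommGroup V] {M : Type*} [TopologicalSpace M]
  {e : OpenPartialHomeomorph M V} {G G' : V → V} {r : ℝ}

open Classical in
/-- The extension by the identity of a self-map of `V`, transported to `M` through a chart. -/
noncomputable def extendByIdentity (e : OpenPartialHomeomorph M V) (G : V → V) (m : M) : M :=
  if m ∈ e.source then e.symm (G (e m)) else m

theorem extendByIdentity_of_mem {m : M} (hm : m ∈ e.source) :
    extendByIdentity e G m = e.symm (G (e m)) := if_pos hm

theorem extendByIdentity_of_notMem {m : M} (hm : m ∉ e.source) :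
    extendByIdentity e G m = m := if_neg hm

theorem extendByIdentity_symm_apply {x : V} (hx : x ∈ e.target) :
    extendByIdentity e G (e.symm x) = e.symm (G x) := by
  rw [extendByIdentity_of_mem (e.map_target hx), e.right_inv hx]

/-- If `G x` falls outside the ball, then `G (G x) = G x`, and injectivity gives `G x = x`. -/
theorem mapsTo_target_of_injective (hr : Metric.closedBall 0 r ⊆ e.target)
    (hG : ∀ x, r ≤ ‖x‖ → G x = x) (hinj : Function.Injective G) :
    MapsTo G e.target e.target := by
  intro x hx
  rcases le_total r ‖G x‖ with h | h
  · rwa [hinj (hG _ h)]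
  · exact hr (mem_closedBall_zero_iff.2 h)

theorem extendByIdentity_comp (hG' : MapsTo G' e.target e.target) (m : M) :
    extendByIdentity e (G ∘ G') m = extendByIdentity e G (extendByIdentity e G' m) := by
  by_cases hm : m ∈ e.source
  · rw [extendByIdentity_of_mem hm, extendByIdentity_of_mem (G := G') hm,
      extendByIdentity_symm_apply (hG' (e.map_source hm)), Function.comp_apply]
  · rw [extendByIdentity_of_notMem hm, extendByIdentity_of_notMem (G := G') hm,
      extendByIdentity_of_notMem hm]

theorem extendByIdentity_id (m : M) : extendByIdentity e id m = m := by
  by_cases hm : m ∈ e.source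
  · rw [extendByIdentity_of_mem hm, id, e.left_inv hm]
  · rw [extendByIdentity_of_notMem hm]

theorem extendByIdentity_extendByIdentity (hG' : MapsTo G' e.target e.target)
    (h : ∀ x, G (G' x) = x) (m : M) : extendByIdentity e G (extendByIdentity e G' m) = m := by
  rw [← extendByIdentity_comp hG', show G ∘ G' = id from funext h, extendByIdentity_id]

theorem extendByIdentity_eq_self (hG : ∀ x, r ≤ ‖x‖ → G x = x) {m : M}
    (hm : m ∉ e.symm '' Metric.closedBall 0 r) : extendByIdentity e G m = m := by
  by_cases h : m ∈ e.source
  · rw [extendByIdentity_of_mem h, hG, e.left_inv h]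
    by_contra! h'
    exact hm ⟨e m, mem_closedBall_zero_iff.2 h'.le, e.left_inv h⟩
  · exact extendByIdentity_of_notMem h

/-- Compact sets are closed in a Hausdorff space. This open set and the chart domain cover `M`, so
regularity of an extension can be checked on each. -/
theorem isOpen_compl_image_closedBall [ProperSpace V] [T2Space M]
    (hr : Metric.closedBall 0 r ⊆ e.target) : IsOpen (e.symm '' Metric.closedBall 0 r)ᶜ :=
  ((isCompact_closedBall (0 : V) r).image_of_continuousOn
    (e.continuousOn_symm.mono hr)).isClosed.isOpen_compl

theorem continuous_extendByIdentity [ProperSpace V] [T2Space M]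
    (hr : Metric.closedBall 0 r ⊆ e.target) (hG : ∀ x, r ≤ ‖x‖ → G x = x) (hc : Continuous G)
    (hmaps : MapsTo G e.target e.target) : Continuous (extendByIdentity e G) := by
  rw [continuous_iff_continuousAt]
  intro m
  by_cases hm : m ∈ e.source
  · have h1 : ContinuousAt (fun m => e.symm (G (e m))) m :=
      ContinuousAt.comp (f := fun m => G (e m)) (g := e.symm)
        (e.continuousAt_symm (hmaps (e.map_source hm)))
        (hc.continuousAt.comp (e.continuousAt hm))
    refine h1.congr ?_
    filter_upwards [e.open_source.mem_nhds hm] with m' hm'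
    exact (extendByIdentity_of_mem hm').symm
  · have hm' : m ∈ (e.symm '' Metric.closedBall 0 r)ᶜ := by
      rintro ⟨x, hx, rfl⟩
      exact hm (e.map_target (hr hx))
    refine continuousAt_id.congr ?_
    filter_upwards [(isOpen_compl_image_closedBall hr).mem_nhds hm'] with m' hm'
    exact (extendByIdentity_eq_self hG hm').symm

theorem minimalPeriod_extendByIdentity (hmaps : MapsTo G e.target e.target) {x : V}
    (hx : x ∈ e.target) :
    Function.minimalPeriod (extendByIdentity e G) (e.symm x) = Function.minimalPeriod G x := by
  rw [Function.minimalPeriod_eq_minimalPeriod_iff]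
  intro k
  have h : (extendByIdentity e G)^[k] (e.symm x) = e.symm (G^[k] x) := by
    induction k with
    | zero => rfl
    | succ k ih =>
      rw [Function.iterate_succ_apply', ih, extendByIdentity_symm_apply (hmaps.iterate k hx),
        Function.iterate_succ_apply']
  rw [Function.IsPeriodicPt, Function.IsFixedPt, h]
  exact e.symm.injOn.eq_iff (hmaps.iterate k hx) hx

theorem mem_interior_minimalPeriod_extendByIdentity (hmaps : MapsTo G e.target e.target) {x : V}
    (hx : x ∈ e.target) (k : ℕ) :
    e.symm x ∈ interior {m | Function.minimalPeriod (extendByIdentity e G) m = k} ↔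
      x ∈ interior {x | Function.minimalPeriod G x = k} := by
  rw [mem_interior_iff_mem_nhds, mem_interior_iff_mem_nhds]
  refine (e.symm.eventually_nhds
    (fun m => Function.minimalPeriod (extendByIdentity e G) m = k) hx).trans ?_
  refine eventually_congr ?_
  filter_upwards [e.open_target.mem_nhds hx] with y hy
  rw [minimalPeriod_extendByIdentity hmaps hy]

theorem contMDiff_extendByIdentity [NormedSpace ℝ V] [ProperSpace V] [T2Space M]
    {E : Type*} [NormedAddCommGroup E] [NormedSpace ℝ E] {H : Type*} [TopologicalSpace H]
    {J : ModelWithCorners ℝ E H} [ChartedSpace H M]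
    {P : Type*} [NormedAddCommGroup P] [NormedSpace ℝ P] {G : P × V → V}
    (he : ContMDiffOn J 𝓘(ℝ, V) ∞ e e.source) (he' : ContMDiffOn 𝓘(ℝ, V) J ∞ e.symm e.target)
    (hr : Metric.closedBall 0 r ⊆ e.target) (hG : ∀ a x, r ≤ ‖x‖ → G (a, x) = x)
    (hc : ContDiff ℝ ∞ G) (hmaps : ∀ a, MapsTo (fun x => G (a, x)) e.target e.target) :
    ContMDiff (𝓘(ℝ, P).prod J) J ∞
      fun q : P × M => extendByIdentity e (fun x => G (q.1, x)) q.2 := by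
  rintro ⟨a, m⟩
  by_cases hm : m ∈ e.source
  · have h1 : ContMDiffAt (𝓘(ℝ, P).prod J) 𝓘(ℝ, P × V) ∞ (fun q : P × M => (q.1, e q.2))
        (a, m) := by
      rw [modelWithCornersSelf_prod, ← chartedSpaceSelf_prod]
      exact contMDiffAt_fst.prodMk
        (ContMDiffAt.comp (a, m) (he.contMDiffAt (e.open_source.mem_nhds hm)) contMDiffAt_snd)
    have h2 : ContMDiffAt (𝓘(ℝ, P).prod J) 𝓘(ℝ, V) ∞ (fun q : P × M => G (q.1, e q.2)) (a, m) :=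
      ContMDiffAt.comp (a, m) hc.contMDiff.contMDiffAt h1
    have h3 : ContMDiffAt (𝓘(ℝ, P).prod J) J ∞ (fun q : P × M => e.symm (G (q.1, e q.2)))
        (a, m) :=
      ContMDiffAt.comp (a, m) (he'.contMDiffAt
        (e.open_target.mem_nhds (hmaps a (e.map_source hm)))) h2
    refine h3.congr_of_eventuallyEq ?_
    filter_upwards [(e.open_source.preimage continuous_snd).mem_nhds
      (show (a, m) ∈ Prod.snd ⁻¹' e.source from hm)] with q hq
    exact extendByIdentity_of_mem hq
  · have hm' : m ∈ (e.symm '' Metric.closedBall 0 r)ᶜ := by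
      rintro ⟨x, hx, rfl⟩
      exact hm (e.map_target (hr hx))
    have h1 : ContMDiffAt (𝓘(ℝ, P).prod J) J ∞ (Prod.snd : P × M → M) (a, m) := contMDiffAt_snd
    refine h1.congr_of_eventuallyEq ?_
    filter_upwards [((isOpen_compl_image_closedBall hr).preimage continuous_snd).mem_nhds
      (show (a, m) ∈ Prod.snd ⁻¹' (e.symm '' Metric.closedBall 0 r)ᶜ from hm')] with q hq
    exact extendByIdentity_eq_self (hG q.1) hq

end Extension

/-! ### What a conjugacy must preserve -/

section Rigidity

variable {W : Type*} [NormedAddCommGroup W]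

theorem tendsto_of_norm_sub_diskCenter_lt {f : Filter ℕ} (hf : f ≤ atTop) {x : ℕ → ℂ × W}
    {a : ℕ → ℝ} {q : ℝ} (hx : ∀ n, ‖x n - diskCenter W n (a n)‖ < diskHeight n)
    (ha : Tendsto a f (𝓝 q)) : Tendsto x f (𝓝 ((q : ℂ), 0)) := by
  have h0 : Tendsto diskHeight f (𝓝 0) := tendsto_diskHeight.mono_left hf
  have h1 : Tendsto (fun n => x n - diskCenter W n (a n)) f (𝓝 0) :=
    squeeze_zero_norm (fun n => (hx n).le) h0
  have h2 : Tendsto (fun n => diskCenter W n (a n)) f (𝓝 ((q : ℂ), 0)) := by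
    have h3 : Tendsto (fun n => (a n : ℂ) + (diskHeight n : ℂ) * Complex.I) f
        (𝓝 ((q : ℂ) + ((0 : ℝ) : ℂ) * Complex.I)) :=
      ((Complex.continuous_ofReal.tendsto q).comp ha).add
        (((Complex.continuous_ofReal.tendsto 0).comp h0).mul_const _)
    rw [Complex.ofReal_zero, zero_mul, add_zero] at h3
    exact h3.prodMk_nhds tendsto_const_nhds
  simpa using h1.add h2

/-- A homeomorphism conjugating the extended twist maps for the positions `a` and `b` maps limits
of positions `a n` to the corresponding limits of positions `b n`. -/
theorem conj_apply_eq_of_tendsto [NormedSpace ℝ W] {M : Type*} [TopologicalSpace M] [T2Space M]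
    {e : OpenPartialHomeomorph M (ℂ × W)} (hr : Metric.closedBall 0 6 ⊆ e.target) {m : ℕ → ℕ}
    (hm : ∀ n, 2 ≤ m n) (hinj : Function.Injective m) {a b : ℕ → ℝ}
    (ha : ∀ n, a n ∈ Icc (0 : ℝ) 1) (hb : ∀ n, b n ∈ Icc (0 : ℝ) 1) (k : M ≃ₜ M)
    (hmaps : ∀ a : ℕ → ℝ, MapsTo (diskTwist (fun n => 2 * Real.pi / m n) a) e.target e.target)
    (hk : ∀ x, k (extendByIdentity e (diskTwist (fun n => 2 * Real.pi / m n) a) x) =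
      extendByIdentity e (diskTwist (fun n => 2 * Real.pi / m n) b) (k x))
    {f : Filter ℕ} [f.NeBot] (hf : f ≤ atTop) {q q' : ℝ} (hq : q ∈ Icc (0 : ℝ) 1)
    (hq' : q' ∈ Icc (0 : ℝ) 1) (haq : Tendsto a f (𝓝 q)) (hbq : Tendsto b f (𝓝 q')) :
    k (e.symm ((q : ℂ), 0)) = e.symm ((q' : ℂ), 0) := by
  have hm0 : ∀ n, m n ≠ 0 := fun n => by have := hm n; omega
  have hmem : ∀ q ∈ Icc (0 : ℝ) 1, ((q : ℂ), (0 : W)) ∈ e.target := fun q hq => by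
    refine hr (mem_closedBall_zero_iff.2 ?_)
    rw [Prod.norm_def, norm_zero, max_le_iff, Complex.norm_real, Real.norm_of_nonneg hq.1]
    exact ⟨by linarith [hq.2], by norm_num⟩
  have key : ∀ n, ∃ x x' : ℂ × W, ‖x - diskCenter W n (a n)‖ < diskHeight n ∧
      ‖x' - diskCenter W n (b n)‖ < diskHeight n ∧ k (e.symm x) = e.symm x' := by
    intro n
    obtain ⟨x, hx4, hx⟩ := exists_mem_interior_minimalPeriod_diskTwist (W := W) hm0 (ha n)
    have hxt : x ∈ e.target := hr (mem_closedBall_zero_iff.2 (by linarith))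
    have hxM := (mem_interior_minimalPeriod_extendByIdentity (hmaps a) hxt _).2 hx
    have hper : ∀ y, Function.minimalPeriod
        (extendByIdentity e (diskTwist (fun n => 2 * Real.pi / m n) b)) (k y) =
        Function.minimalPeriod
          (extendByIdentity e (diskTwist (fun n => 2 * Real.pi / m n) a)) y := by
      intro y
      rw [Function.minimalPeriod_eq_minimalPeriod_iff]
      intro j
      have hsemi : Function.Semiconj k
          (extendByIdentity e (diskTwist (fun n => 2 * Real.pi / m n) a))
          (extendByIdentity e (diskTwist (fun n => 2 * Real.pi / m n) b)) := hk
      rw [Function.IsPeriodicPt, Function.IsFixedPt, ← (hsemi.iterate_right j).eq,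
        k.injective.eq_iff]
      rfl
    have hkx : k (e.symm x) ∈ interior {y | Function.minimalPeriod
        (extendByIdentity e (diskTwist (fun n => 2 * Real.pi / m n) b)) y = m n} := by
      rw [← mem_preimage, k.preimage_interior]
      convert! hxM using 2
      ext y
      simp only [mem_preimage, mem_ofPred_eq, hper]
    -- Outside the chart the twist is the identity, so all periods there are `1 < m n`.
    have hks : k (e.symm x) ∈ e.source := by
      by_contra h
      have h1 : Function.minimalPeriod
          (extendByIdentity e (diskTwist (fun n => 2 * Real.pi / m n) b)) (k (e.symm x)) = 1 :=
        Function.minimalPeriod_eq_one_iff_isFixedPt.2 (extendByIdentity_of_notMem h)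
      have h2 := interior_subset hkx
      rw [mem_ofPred_eq, h1] at h2
      have := hm n
      omega
    refine ⟨x, e (k (e.symm x)), ?_, ?_, (e.left_inv hks).symm⟩
    · exact norm_sub_diskCenter_lt_of_mem_interior hm hinj ha hx
    · refine norm_sub_diskCenter_lt_of_mem_interior hm hinj hb ?_
      rw [← mem_interior_minimalPeriod_extendByIdentity (hmaps b) (e.map_source hks),
        e.left_inv hks]
      exact hkx
  choose x x' hx hx' hkx using key
  have h1 : Tendsto (fun n => k (e.symm (x n))) f (𝓝 (k (e.symm ((q : ℂ), 0)))) :=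
    (k.continuous.tendsto _).comp ((e.continuousAt_symm (hmem q hq)).tendsto.comp
      (tendsto_of_norm_sub_diskCenter_lt hf hx haq))
  have h2 : Tendsto (fun n => e.symm (x' n)) f (𝓝 (e.symm ((q' : ℂ), 0))) :=
    (e.continuousAt_symm (hmem q' hq')).tendsto.comp
      (tendsto_of_norm_sub_diskCenter_lt hf hx' hbq)
  exact tendsto_nhds_unique (h1.congr hkx) h2

end Rigidity

/-! ### Interleaving with a dense sequence -/

section Interleave

/-- The sequence `α` interleaved with a sequence that takes each value of a dense sequence
infinitely often. -/
noncomputable def interleaveDense (α : ℕ → I) (n : ℕ) : I :=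
  if Even n then α (n / 2) else TopologicalSpace.denseSeq I (n / 2).unpair.1

theorem interleaveDense_two_mul (α : ℕ → I) (n : ℕ) : interleaveDense α (2 * n) = α n := by
  simp [interleaveDense]

theorem interleaveDense_two_mul_pair_add_one (α : ℕ → I) (i j : ℕ) :
    interleaveDense α (2 * Nat.pair i j + 1) = TopologicalSpace.denseSeq I i := by
  have h : (2 * Nat.pair i j + 1) / 2 = Nat.pair i j := by omega
  simp [interleaveDense, h]

theorem continuous_interleaveDense : Continuous interleaveDense := by
  refine continuous_pi fun n => ?_
  by_cases hn : Even n
  · simp only [interleaveDense, if_pos hn]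
    exact continuous_apply _
  · simp only [interleaveDense, if_neg hn]
    exact continuous_const

theorem tendsto_interleaveDense_sub {α β : ℕ → I}
    (h : Tendsto (fun n => (α n : ℝ) - (β n : ℝ)) atTop (𝓝 0)) :
    Tendsto (fun n => (interleaveDense β n : ℝ) - (interleaveDense α n : ℝ)) atTop (𝓝 0) := by
  have h2 : Tendsto (fun n : ℕ => n / 2) atTop atTop := Nat.tendsto_div_const_atTop two_ne_zero
  refine squeeze_zero_norm (fun n => ?_) (by simpa using (h.comp h2).norm)
  by_cases hn : Even n
  · simp [interleaveDense, hn, abs_sub_comm]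
  · simp [interleaveDense, hn]

end Interleave

/-- The dense values occurring infinitely often in both sequences make `k` fix the segment. By
compactness, `α` and `β` converge along any ultrafilter, and `k` takes one limit to the other, so
the limits agree. -/
theorem tendsto_sub_of_conj {W : Type*} [NormedAddCommGroup W] [NormedSpace ℝ W] {M : Type*}
    [TopologicalSpace M] [T2Space M] {e : OpenPartialHomeomorph M (ℂ × W)}
    (hr : Metric.closedBall 0 6 ⊆ e.target) {m : ℕ → ℕ} (hm : ∀ n, 2 ≤ m n)
    (hinj : Function.Injective m) {α β : ℕ → I} (k : M ≃ₜ M)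
    (hmaps : ∀ a : ℕ → ℝ, MapsTo (diskTwist (fun n => 2 * Real.pi / m n) a) e.target e.target)
    (hk : ∀ x, k (extendByIdentity e (diskTwist (fun n => 2 * Real.pi / m n)
        fun n => interleaveDense α n) x) =
      extendByIdentity e (diskTwist (fun n => 2 * Real.pi / m n)
        fun n => interleaveDense β n) (k x)) :
    Tendsto (fun n => (α n : ℝ) - (β n : ℝ)) atTop (𝓝 0) := by
  have key := fun {f : Filter ℕ} [f.NeBot] (hf : f ≤ atTop) (q q' : I) =>
    conj_apply_eq_of_tendsto hr hm hinj (fun n => (interleaveDense α n).2)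
      (fun n => (interleaveDense β n).2) k hmaps hk hf q.2 q'.2
  have hmem : ∀ q : I, (((q : ℝ) : ℂ), (0 : W)) ∈ e.target := fun q => by
    refine hr (mem_closedBall_zero_iff.2 ?_)
    rw [Prod.norm_def, norm_zero, max_le_iff, Complex.norm_real, Real.norm_of_nonneg q.2.1]
    exact ⟨by linarith [q.2.2], by norm_num⟩
  have hcont : Continuous fun q : I => e.symm (((q : ℝ) : ℂ), (0 : W)) :=
    e.continuousOn_symm.comp_continuous (by fun_prop) hmem
  have hfix : (fun q : I => k (e.symm (((q : ℝ) : ℂ), (0 : W)))) =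
      fun q : I => e.symm (((q : ℝ) : ℂ), (0 : W)) := by
    refine (TopologicalSpace.denseRange_denseSeq I).equalizer (k.continuous.comp hcont) hcont ?_
    funext i
    -- Along these indices both interleaved sequences are constant, equal to the `i`-th dense value.
    have hlim : Tendsto (fun j => 2 * Nat.pair i j + 1) atTop atTop :=
      tendsto_atTop_mono (fun j => by have := Nat.right_le_pair i j; rw [id]; omega) tendsto_id
    have hconst : ∀ γ : ℕ → I, Tendsto (fun n => (interleaveDense γ n : ℝ))
        (map (fun j => 2 * Nat.pair i j + 1) atTop)
        (𝓝 (TopologicalSpace.denseSeq I i : ℝ)) := fun γ => by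
      rw [tendsto_map'_iff]
      refine tendsto_const_nhds.congr fun j => ?_
      rw [Function.comp_apply, interleaveDense_two_mul_pair_add_one]
    exact key hlim _ _ (hconst α) (hconst β)
  rw [tendsto_iff_ultrafilter]
  intro U hU
  obtain ⟨q, -, hq⟩ := isCompact_univ.ultrafilter_le_nhds (U.map α) (by simp)
  obtain ⟨q', -, hq'⟩ := isCompact_univ.ultrafilter_le_nhds (U.map β) (by simp)
  have hα : Tendsto (fun n => (α n : ℝ)) U (𝓝 q) := (continuous_subtype_val.tendsto q).comp hq
  have hβ : Tendsto (fun n => (β n : ℝ)) U (𝓝 q') := (continuous_subtype_val.tendsto q').comp hq'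
  have hlim : Tendsto (fun n => 2 * n) (U : Filter ℕ) atTop :=
    (tendsto_atTop_mono (fun n => by simp only [id]; omega) tendsto_id).mono_left hU
  have heq : ∀ {γ : ℕ → I} {p : I}, Tendsto (fun n => (γ n : ℝ)) U (𝓝 p) →
      Tendsto (fun n => (interleaveDense γ n : ℝ)) (map (fun n => 2 * n) U) (𝓝 p) := by
    intro γ p h
    rw [tendsto_map'_iff]
    exact h.congr fun n => by rw [Function.comp_apply, interleaveDense_two_mul]
  have h1 := key hlim q q' (heq hα) (heq hβ)
  rw [congrFun hfix q] at h1
  have h2 := e.symm.injOn (hmem q) (hmem q') h1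
  have h3 : (q : ℝ) = q' := Complex.ofReal_injective (congrArg Prod.fst h2)
  have h4 := hα.sub hβ
  rwa [h3, sub_self] at h4

/-! ### Assembling the reduction -/

theorem mapsTo_diskTwist {W : Type*} [NormedAddCommGroup W] {M : Type*} [TopologicalSpace M]
    {e : OpenPartialHomeomorph M (ℂ × W)} (hr : Metric.closedBall 0 4 ⊆ e.target) (θ a : ℕ → ℝ) :
    MapsTo (diskTwist θ a) e.target e.target :=
  mapsTo_target_of_injective hr (fun _ => diskTwist_of_four_le_norm θ a)
    (Function.LeftInverse.injective (diskTwist_neg_diskTwist θ a))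

theorem exists_homeomorph_conj_extendByIdentity_diskTwist {W : Type*} [NormedAddCommGroup W]
    [NormedSpace ℝ W] [FiniteDimensional ℝ W] {M : Type*} [TopologicalSpace M] [T2Space M]
    {e : OpenPartialHomeomorph M (ℂ × W)} (hr : Metric.closedBall 0 6 ⊆ e.target) (θ : ℕ → ℝ)
    {a b : ℕ → ℝ} (ha : ∀ n, a n ∈ Icc (0 : ℝ) 1) (hb : ∀ n, b n ∈ Icc (0 : ℝ) 1)
    (hab : Tendsto (fun n => b n - a n) atTop (𝓝 0)) :
    ∃ h : M ≃ₜ M, ∀ x, h (extendByIdentity e (diskTwist θ a) x) =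
      extendByIdentity e (diskTwist θ b) (h x) := by
  have : ProperSpace (ℂ × W) := FiniteDimensional.proper ℝ _
  have hr4 : Metric.closedBall 0 4 ⊆ e.target :=
    (Metric.closedBall_subset_closedBall (by norm_num)).trans hr
  obtain ⟨h, hsupp, hconj⟩ := exists_homeomorph_conj_diskTwist (W := W) θ ha hb hab
  have hsupp' : ∀ x, 6 ≤ ‖x‖ → h.symm x = x := fun x hx => by
    rw [Homeomorph.symm_apply_eq, hsupp x hx]
  have hmh := mapsTo_target_of_injective hr hsupp h.injective
  have hmh' := mapsTo_target_of_injective hr hsupp' h.symm.injective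
  refine ⟨{ toFun := extendByIdentity e h
            invFun := extendByIdentity e h.symm
            left_inv := extendByIdentity_extendByIdentity hmh h.symm_apply_apply
            right_inv := extendByIdentity_extendByIdentity hmh' h.apply_symm_apply
            continuous_toFun := continuous_extendByIdentity hr hsupp h.continuous hmh
            continuous_invFun :=
              continuous_extendByIdentity hr hsupp' h.symm.continuous hmh' }, fun x => ?_⟩
  change extendByIdentity e h (extendByIdentity e (diskTwist θ a) x) =
    extendByIdentity e (diskTwist θ b) (extendByIdentity e h x)
  rw [← extendByIdentity_comp (mapsTo_diskTwist hr4 _ _), ← extendByIdentity_comp hmh]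
  exact congrArg (fun G => extendByIdentity e G x) (funext hconj)

/-- For suitable periods, the extended twist maps are diffeomorphisms of the manifold that depend
continuously on the positions of the disks. -/
theorem exists_continuous_smoothDiffeo_diskTwist {W : Type*} [NormedAddCommGroup W]
    [InnerProductSpace ℝ W] [FiniteDimensional ℝ W] {E : Type*} [NormedAddCommGroup E]
    [NormedSpace ℝ E] {H : Type*} [TopologicalSpace H] {J : ModelWithCorners ℝ E H} {M : Type*}
    [TopologicalSpace M] [T2Space M] [ChartedSpace H M] {e : OpenPartialHomeomorph M (ℂ × W)}
    (he : ContMDiffOn J 𝓘(ℝ, ℂ × W) ∞ e e.source)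
    (he' : ContMDiffOn 𝓘(ℝ, ℂ × W) J ∞ e.symm e.target)
    (hr : Metric.closedBall 0 4 ⊆ e.target) :
    ∃ m : ℕ → ℕ, (∀ n, 2 ≤ m n) ∧ Function.Injective m ∧
      ∃ D : (ℕ → I) → SmoothDiffeo J M, Continuous D ∧ ∀ α x, D α x =
        extendByIdentity e (diskTwist (fun n => 2 * Real.pi / m n) fun n => α n) x := by
  have : ProperSpace (ℂ × W) := FiniteDimensional.proper ℝ _
  obtain ⟨ι, c, hι, hcι⟩ := exists_continuous_cube_embedding
  obtain ⟨δ, hδ, hsmooth⟩ := exists_forall_contDiff_diskTwist (W := W) c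
  obtain ⟨m, hmono, hm⟩ := exists_strictMono_two_pi_div_le hδ
  -- Stated for all small `θ`, so that it also covers the inverse, which is the twist by `-θ`.
  have hΦ : ∀ θ : ℕ → ℝ, (∀ n, |θ n| ≤ δ n) →
      ContMDiff (𝓘(ℝ, BoundedContinuousFunction ℕ ℝ).prod J) J ∞
        fun q : BoundedContinuousFunction ℕ ℝ × M =>
          extendByIdentity e (diskTwist θ fun n => c n q.1) q.2 := by
    intro θ hθ
    let G : BoundedContinuousFunction ℕ ℝ × (ℂ × W) → ℂ × W := fun q =>
      diskTwist θ (fun n => c n q.1) q.2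
    have hsupp : ∀ a x, 4 ≤ ‖x‖ → G (a, x) = x := fun a x hx =>
      diskTwist_of_four_le_norm θ (fun n => c n a) hx
    have hmaps : ∀ a, MapsTo (fun x => G (a, x)) e.target e.target := fun a =>
      mapsTo_diskTwist hr θ fun n => c n a
    have h := contMDiff_extendByIdentity he he' hr hsupp (hsmooth θ hθ) hmaps
    exact h
  have hslice : ∀ θ : ℕ → ℝ, (∀ n, |θ n| ≤ δ n) → ∀ a : BoundedContinuousFunction ℕ ℝ,
      ContMDiff J J ∞ (extendByIdentity e (diskTwist θ fun n => c n a)) := fun θ hθ a =>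
    (hΦ θ hθ).comp (contMDiff_const.prodMk contMDiff_id)
  obtain ⟨θ, hθ⟩ : ∃ θ : ℕ → ℝ, θ = fun n => 2 * Real.pi / m n := ⟨_, rfl⟩
  have hθδ : ∀ n, |θ n| ≤ δ n := fun n => by
    rw [hθ, abs_of_nonneg (by positivity)]
    exact (hm n).2
  obtain ⟨D, hD⟩ : ∃ D : BoundedContinuousFunction ℕ ℝ → SmoothDiffeo J M, ∀ a x,
      D a x = extendByIdentity e (diskTwist θ fun n => c n a) x :=
    ⟨fun a =>
      { toFun := extendByIdentity e (diskTwist θ fun n => c n a)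
        invFun := extendByIdentity e (diskTwist (-θ) fun n => c n a)
        left_inv := extendByIdentity_extendByIdentity (mapsTo_diskTwist hr _ _)
          (diskTwist_neg_diskTwist _ _)
        right_inv := extendByIdentity_extendByIdentity (mapsTo_diskTwist hr _ _)
          (diskTwist_diskTwist_neg _ _)
        contMDiff_toFun := hslice θ hθδ a
        contMDiff_invFun := hslice (-θ) (fun n => by simpa using hθδ n) a }, fun _ _ => rfl⟩
  refine ⟨m, fun n => (hm n).1, hmono.injective, D ∘ ι,
    (continuous_smoothDiffeo_of_contMDiff (hΦ θ hθδ) D hD).comp hι, fun α x => ?_⟩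
  rw [Function.comp_apply, hD]
  simp only [hcι, hθ]

theorem mainTheorem2
    {E : Type*} [NormedAddCommGroup E] [NormedSpace ℝ E] [FiniteDimensional ℝ E]
    (hdim : 2 ≤ Module.finrank ℝ E)
    {H : Type*} [TopologicalSpace H] (J : ModelWithCorners ℝ E H)
    (M : Type*) [TopologicalSpace M] [ChartedSpace H M] [IsManifold J ∞ M]
    [T2Space M] [SecondCountableTopology M] [Nonempty M] :
    BorelReducible c0Relation (topConjugacy J M) := by
  obtain ⟨d, hd⟩ := Nat.exists_eq_add_of_le hdim
  have hrank : Module.finrank ℝ E = Module.finrank ℝ (ℂ × EuclideanSpace ℝ (Fin d)) := by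
    rw [Module.finrank_prod, Complex.finrank_real_complex, finrank_euclideanSpace_fin, hd]
  -- Radius `4` contains the support of the twists, radius `6` that of the slide.
  obtain ⟨e, hr, he, he'⟩ := exists_openPartialHomeomorph_closedBall_subset
    (ContinuousLinearEquiv.ofFinrankEq hrank) J M 6
  have hr4 : Metric.closedBall 0 4 ⊆ e.target :=
    (Metric.closedBall_subset_closedBall (by norm_num)).trans hr
  obtain ⟨m, hm, hinj, D, hD, hDα⟩ := exists_continuous_smoothDiffeo_diskTwist he he' hr4
  have hcont : Continuous fun α => D (interleaveDense α) := hD.comp continuous_interleaveDense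
  refine ⟨fun α => D (interleaveDense α), ?_, fun α β => ⟨fun h => ?_, ?_⟩⟩
  · exact @measurable_generateFrom _ _ (borel _) _ _ fun t ht =>
      MeasurableSpace.measurableSet_generateFrom (IsOpen.preimage hcont ht)
  · obtain ⟨k, hk⟩ := exists_homeomorph_conj_extendByIdentity_diskTwist hr
      (fun n => 2 * Real.pi / m n) (fun n => (interleaveDense α n).2)
      (fun n => (interleaveDense β n).2) (tendsto_interleaveDense_sub h)
    exact ⟨k, fun x => by rw [hDα, hDα]; exact hk x⟩
  · rintro ⟨k, hk⟩
    refine tendsto_sub_of_conj hr hm hinj k (mapsTo_diskTwist hr4 _) fun x => ?_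
    rw [← hDα, ← hDα]
    exact hk x
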